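/- **Setting.** A reward-mixing Markov decision process (RMMDP) consists of a finite non-empty state space $\mathcal S$ and action space $\mathcal A$, of sizes $S$ and $A$; a transition kernel $T(s'\mid s,a)$ and an initial state distribution $\nu$; a finite set $\mathcal Z\subset[-1,1]$ of reward values, of size $Z$; mixing weights $w_1,\dots,w_M\ge 0$ with $\sum_m w_m=1$; and $M$ reward models, $\mu_m(s,a,\cdot)$ being a probability distribution on $\mathcal Z$ for all $m,s,a$. In an episode of length $H\ge 1$, a latent context $m$ is drawn with probability $w_m$, once and unobserved, and $s_1\sim\nu$. At each step $t=1,\dots,H$ the agent observes $s_t$, plays $a_t$ and observes a reward $r_t\sim\mu_m(s_t,a_t,\cdot)$, and $s_{t+1}\sim T(\cdot\mid s_t,a_t)$. A policy chooses $a_t$ as a function of $(s_1,a_1,r_1,\dots,s_{t-1},a_{t-1},r_{t-1},s_t)$. Its value $V^\pi$ is the expectation of $\sum_{t=1}^H r_t$, and $\pi$ is $\epsilon$-optimal if $V^\pi\ge \max_{\pi'}V^{\pi'}-\epsilon$. A $K$-episode learning algorithm chooses the policy of each of $K$ successive independent episodes as a function of the observed trajectories of the earlier episodes, and finally returns a policy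 as a function of all $K$ observed trajectories. **Theorem (Sample complexity of learning RMMDPs with $M\ge 2$).** There are a universal constant $C>0$ and universal polynomials $\mathrm{poly}$ (in three variables) and $q$ (in one variable), with $\mathrm{polylog}(x):=q(\log x)$, such that the following holds. Let $\mathcal S,\mathcal A$ be finite and non-empty, $\mathcal Z\subset[-1,1]$ finite, $M\ge2$, $H\ge1$, $\epsilon,\eta\in(0,1)$, and $d=\min(2M-1,H)$. For every natural number $K$ with $$K\;\ge\; C\cdot\frac{(SA)^d}{\epsilon^2}\cdot \mathrm{poly}(d,H,Z)^d\cdot \mathrm{polylog}(K/\eta)$$ there is a $K$-episode learning algorithm, which may depend on $\mathcal S,\mathcal A,\mathcal Z,H,M,\epsilon,\eta,K$ only, that for every RMMDP on $\mathcal S,\mathcal A,\mathcal Z$ with $M$ latent reward models (with $T,\nu,w,\mu$ all unknown to the algorithm) returns an $\epsilon$-optimal policy with probability at least $1-\eta$. -/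

import Mathlib

noncomputable section

/-- A reward-mixing Markov decision process on finite state space `S` and action space `A`, with
reward values in the finite set `𝒵` and `M` latent reward models. -/
structure RMMDP (S A : Type) [Fintype S] [Fintype A] (𝒵 : Finset ℝ) (M : ℕ) where
  /-- transition probabilities: `T s a s'` is the probability of moving from `s` to `s'` under `a` -/
  T : S → A → S → ℝ
  T_mem : ∀ s a, T s a ∈ stdSimplex ℝ S
  /-- initial state distribution -/
  ν : S → ℝ
  ν_mem : ν ∈ stdSimplex ℝ S
  /-- mixing weights -/
  w : Fin M → ℝ
  w_mem : w ∈ stdSimplex ℝ (Fin M)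
  /-- latent reward models: `μ m s a z` is the probability of reward `z` in context `m` at `(s, a)` -/
  μ : Fin M → S → A → 𝒵 → ℝ
  μ_mem : ∀ m s a, μ m s a ∈ stdSimplex ℝ 𝒵

/-- History-dependent policies: the action is a function of the past (state, action, reward)
triples of the current episode, oldest first, and of the current state. -/
abbrev Policy (S A : Type) (𝒵 : Finset ℝ) : Type := List (S × A × 𝒵) → S → A

/-- Trajectories of one episode: `H` triples (state, action, observed reward). -/
abbrev Trajectory (S A : Type) (𝒵 : Finset ℝ) (H : ℕ) : Type := Fin H → S × A × 𝒵

/-- The entries of `x` strictly before position `t`, in order. -/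
def past {α : Type} {n : ℕ} (x : Fin n → α) (t : Fin n) : List α := (List.ofFn x).take t

/-- Sum of the rewards along a trajectory. -/
def totalReward {S A : Type} {𝒵 : Finset ℝ} {H : ℕ} (τ : Trajectory S A 𝒵 H) : ℝ :=
  ∑ t, ((τ t).2.2 : ℝ)

namespace RMMDP

variable {S A : Type} [Fintype S] [Fintype A] {𝒵 : Finset ℝ} {M H : ℕ}

/-- Probability of the state `s_t` given the previous state-action pair: `ν (s_1)` at the first step
and `T (s_t | s_{t-1}, a_{t-1})` later. -/
def stateProb (𝓜 : RMMDP S A 𝒵 M) (τ : Trajectory S A 𝒵 H) (t : Fin H) : ℝ :=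
  if (t : ℕ) = 0 then 𝓜.ν (τ t).1
  else 𝓜.T (τ ⟨t - 1, by omega⟩).1 (τ ⟨t - 1, by omega⟩).2.1 (τ t).1

open Classical in
/-- Probability (`0` or `1`) that the policy `π` takes the action `a_t` at its history `h_t`. -/
def actionProb (π : Policy S A 𝒵) (τ : Trajectory S A 𝒵 H) (t : Fin H) : ℝ :=
  if (τ t).2.1 = π (past τ t) (τ t).1 then 1 else 0

/-- Probability of the observed rewards given the state-action pairs; the latent context is drawn
once, at the beginning of the episode. -/
def rewardProb (𝓜 : RMMDP S A 𝒵 M) (τ : Trajectory S A 𝒵 H) : ℝ :=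
  ∑ m, 𝓜.w m * ∏ t, 𝓜.μ m (τ t).1 (τ t).2.1 (τ t).2.2

/-- Probability that an episode of `𝓜` played with the policy `π` has trajectory `τ`. -/
def trajProb (𝓜 : RMMDP S A 𝒵 M) (π : Policy S A 𝒵) (τ : Trajectory S A 𝒵 H) : ℝ :=
  (∏ t, 𝓜.stateProb τ t) * (∏ t, actionProb π τ t) * 𝓜.rewardProb τ

/-- Expected cumulative reward of `π` in an episode of `H` steps. -/
def value (𝓜 : RMMDP S A 𝒵 M) (H : ℕ) (π : Policy S A 𝒵) : ℝ :=
  ∑ τ : Trajectory S A 𝒵 H, 𝓜.trajProb π τ * totalReward τ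

/-- Optimal value over all history-dependent policies (the supremum is over a bounded set, see
`bddAbove_range_value`). -/
def optimalValue (𝓜 : RMMDP S A 𝒵 M) (H : ℕ) : ℝ := ⨆ π : Policy S A 𝒵, 𝓜.value H π

/-- `π` is `ε`-optimal. -/
def IsEpsOptimal (𝓜 : RMMDP S A 𝒵 M) (H : ℕ) (ε : ℝ) (π : Policy S A 𝒵) : Prop :=
  𝓜.optimalValue H - ε ≤ 𝓜.value H π

theorem bddAbove_range_value (𝓜 : RMMDP S A 𝒵 M) (H : ℕ) :
    BddAbove (Set.range fun π : Policy S A 𝒵 => 𝓜.value H π) := by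
  refine ⟨∑ τ : Trajectory S A 𝒵 H,
    |∏ t, 𝓜.stateProb τ t| * |𝓜.rewardProb τ| * |totalReward τ|, ?_⟩
  rintro _ ⟨π, rfl⟩
  refine Finset.sum_le_sum fun τ _ => ?_
  have h0 : 0 ≤ ∏ t, actionProb π τ t :=
    Finset.prod_nonneg fun t _ => by unfold actionProb; split_ifs <;> norm_num
  have h1 : ∏ t, actionProb π τ t ≤ 1 :=
    Finset.prod_le_one (fun t _ => by unfold actionProb; split_ifs <;> norm_num)
      (fun t _ => by unfold actionProb; split_ifs <;> norm_num)
  refine (le_abs_self _).trans ?_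
  rw [trajProb, abs_mul, abs_mul, abs_mul, abs_of_nonneg h0]
  gcongr
  exact mul_le_of_le_one_right (abs_nonneg _) h1

end RMMDP

/-- A learning algorithm interacting with an unknown model for `K` episodes of length `H`: the
policy played in an episode is a function of the trajectories of the earlier episodes, and after
the last episode a policy is returned as a function of all `K` trajectories. -/
structure Learner (S A : Type) (𝒵 : Finset ℝ) (H K : ℕ) where
  explore : List (Trajectory S A 𝒵 H) → Policy S A 𝒵
  output : (Fin K → Trajectory S A 𝒵 H) → Policy S A 𝒵

namespace Learner

variable {S A : Type} [Fintype S] [Fintype A] {𝒵 : Finset ℝ} {M H K : ℕ}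

/-- Probability that the `K` episodes played by the algorithm in the model `𝓜` have the
trajectories `D 0, …, D (K - 1)`. -/
def dataProb (L : Learner S A 𝒵 H K) (𝓜 : RMMDP S A 𝒵 M)
    (D : Fin K → Trajectory S A 𝒵 H) : ℝ :=
  ∏ k, 𝓜.trajProb (L.explore (past D k)) (D k)

open Classical in
/-- Probability that the policy returned by the algorithm is `ε`-optimal for the model `𝓜`. -/
def successProb (L : Learner S A 𝒵 H K) (𝓜 : RMMDP S A 𝒵 M) (ε : ℝ) : ℝ :=
  ∑ D : Fin K → Trajectory S A 𝒵 H,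
    if 𝓜.IsEpsOptimal H ε (L.output D) then L.dataProb 𝓜 D else 0

end Learner

end

/-!
# Learning reward-mixing MDPs

Fix a policy and transition probabilities. The law of an episode then differs between two
models only through the reward factor, a mixture of `M` products in each model. The difference of
the two factors is a signed combination of products over `2 * M` atoms. Writing
`y i t = y j t + (y i t - y j t)` for a chosen atom `j`, one factor at a time, expands such a
combination as in Newton interpolation: every use of the second summand kills one atom, so after
`2 * M` uses nothing is left (`exists_newton_family`). Hence the difference is controlled by the
differences of joint reward laws at no more than `d = min (2 * M - 1) H` times. In the expansion the
rewards at these times are imposed, which costs a factor `|𝒵|` each, and the others are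
drawn from one of the atoms; what remains is the expectation of a function of states and actions
under a policy with simulated rewards, hence at most the optimal value of a planning problem on
state-action pairs (`sum_abs_rewardProb_sub_le`, `chainSum_stepKernel_le_optSum`). Together with the
simulation lemma for the transitions (`abs_chainSum_sub_le`) this bounds all value differences
(`abs_value_sub_le`).

It remains to know the joint laws of rewards at `d`-tuples of state-action pairs, and the
transitions, wherever some policy may go. The algorithm counts, for every set `B` of at most `d`
times, the visits to each tuple of state-action pairs at these times. It explores with policies that
ignore rewards, so that the rewards at `B` given the state-action pairs there follow exactly their
joint law (`sum_trajProb_rewardEvent`). An exponential supermartingale with a fixed parameter `r`,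
of order `ε`, gives deviations of relative size `r` plus `L / (r * N)` after `N` visits
(`chainSum_ind_not_closeCount_le`); so the exploration bonus is inversely proportional to the number
of visits, and its sum over episodes is logarithmic for each of the `(S A) ^ d` tuples
(`runSum_bonus_le`). Each episode is played with a policy maximising the bonus in some model that is
consistent with the data. As two consistent models also have close transitions where the bonus is
small, the bonus of that policy in the true model is comparable to the largest possible one
(`chainSum_totalBonus_le`), and since all bonuses met have a small sum, in some episode the largest
bonus is small. At that time the values in any consistent model agree with the true ones up to
`ε / 3`, and the algorithm returns a nearly optimal policy of such a model (`exists_learner`).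
-/

noncomputable section

namespace RewardMixing

/-! ### Expectations along chains -/

section Chain

variable {α : Type}

theorem past_cons_zero {n : ℕ} (a : α) (x : Fin n → α) :
    past (Fin.cons a x : Fin (n + 1) → α) 0 = [] := by
  simp [past]

theorem past_cons_succ {n : ℕ} (a : α) (x : Fin n → α) (t : Fin n) :
    past (Fin.cons a x : Fin (n + 1) → α) t.succ = a :: past x t := by
  simp [past, List.ofFn_succ]

theorem length_past {n : ℕ} (x : Fin n → α) (t : Fin n) : (past x t).length = t := by
  simp [past]

theorem map_past {β : Type} {n : ℕ} (f : α → β) (x : Fin n → α) (t : Fin n) :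
    (past x t).map f = past (fun i => f (x i)) t := by
  simp only [past, List.map_take, List.map_ofFn]; rfl

/-- Sum of `e` over all proper prefixes of a list. -/
def prefixSum (e : List α → ℝ) (l : List α) : ℝ := ∑ t ∈ Finset.range l.length, e (l.take t)

theorem prefixSum_append_singleton (e : List α → ℝ) (h : List α) (a : α) :
    prefixSum e (h ++ [a]) = prefixSum e h + e h := by
  rw [prefixSum, List.length_append, List.length_singleton, Finset.sum_range_succ, prefixSum]
  congr 1
  · refine Finset.sum_congr rfl fun t ht => ?_
    rw [List.take_append_of_le_length (Finset.mem_range.1 ht).le]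
  · simp

/-- Sum of `φ (prefix before the entry) entry` over the entries of a list. -/
def runSum (φ : List α → α → ℝ) (l : List α) : ℝ :=
  ∑ i ∈ Finset.range l.length, (l[i]?).elim 0 (φ (l.take i))

theorem runSum_append_singleton (φ : List α → α → ℝ) (h : List α) (a : α) :
    runSum φ (h ++ [a]) = runSum φ h + φ h a := by
  rw [runSum, List.length_append, List.length_singleton, Finset.sum_range_succ, runSum]
  congr 1
  · refine Finset.sum_congr rfl fun t ht => ?_
    rw [List.take_append_of_le_length (Finset.mem_range.1 ht).le,
      List.getElem?_append_left (Finset.mem_range.1 ht)]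
  · simp

variable [Fintype α]

/-- `chainSum p F n h` is the expectation of `F` at the list obtained from `h` by appending `n`
random entries, each drawn from the kernel `p` given the list so far. -/
def chainSum (p : List α → α → ℝ) (F : List α → ℝ) : ℕ → List α → ℝ
  | 0, h => F h
  | n + 1, h => ∑ a, p h a * chainSum p F n (h ++ [a])

/-- `p` is a probability kernel from lists to the next entry. -/
def IsKernel (p : List α → α → ℝ) : Prop := ∀ h, (∀ a, 0 ≤ p h a) ∧ ∑ a, p h a = 1

theorem sum_prod_append_past (p : List α → α → ℝ) (F : List α → ℝ) (n : ℕ) (h : List α) :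
    ∑ x : Fin n → α, (∏ t, p (h ++ past x t) (x t)) * F (h ++ List.ofFn x)
      = chainSum p F n h := by
  induction n generalizing h with
  | zero => simp [chainSum]
  | succ n ih =>
    rw [← (Fin.consEquiv (fun _ => α)).sum_comp, Fintype.sum_prod_type, chainSum]
    refine Finset.sum_congr rfl fun a _ => ?_
    rw [← ih, Finset.mul_sum]
    refine Finset.sum_congr rfl fun x _ => ?_
    simp only [Fin.consEquiv, Equiv.coe_fn_mk]
    rw [Fin.prod_univ_succ]
    simp only [past_cons_zero, past_cons_succ, Fin.cons_zero, Fin.cons_succ, List.ofFn_succ,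
      List.append_nil, List.append_assoc, List.singleton_append]
    ring

theorem sum_prod_past (p : List α → α → ℝ) (F : List α → ℝ) (n : ℕ) :
    ∑ x : Fin n → α, (∏ t, p (past x t) (x t)) * F (List.ofFn x) = chainSum p F n [] := by
  simpa using sum_prod_append_past p F n []

variable {p : List α → α → ℝ}

theorem chainSum_add (F G : List α → ℝ) (n : ℕ) (h : List α) :
    chainSum p (fun l => F l + G l) n h = chainSum p F n h + chainSum p G n h := by
  induction n generalizing h with
  | zero => rfl
  | succ n ih => simp only [chainSum, ih, mul_add, Finset.sum_add_distrib]

theorem chainSum_const_mul (c : ℝ) (F : List α → ℝ) (n : ℕ) (h : List α) :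
    chainSum p (fun l => c * F l) n h = c * chainSum p F n h := by
  induction n generalizing h with
  | zero => rfl
  | succ n ih =>
    simp only [chainSum, ih, Finset.mul_sum]
    exact Finset.sum_congr rfl fun a _ => by ring

theorem chainSum_mono (hp : ∀ h a, 0 ≤ p h a) {F G : List α → ℝ} (n : ℕ) (h : List α)
    (hFG : ∀ l, l.length = h.length + n → F l ≤ G l) : chainSum p F n h ≤ chainSum p G n h := by
  induction n generalizing h with
  | zero => exact hFG h (by simp)
  | succ n ih =>
    refine Finset.sum_le_sum fun a _ =>
      mul_le_mul_of_nonneg_left (ih _ fun l hl => hFG l ?_) (hp _ _)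
    rw [hl, List.length_append, List.length_singleton]; ring

theorem chainSum_eq_of_prefix (hp : IsKernel p) {F : List α → ℝ} {c : ℝ} (n : ℕ) (h : List α)
    (hF : ∀ r, F (h ++ r) = c) : chainSum p F n h = c := by
  induction n generalizing h with
  | zero => simpa [chainSum] using hF []
  | succ n ih =>
    rw [chainSum, Finset.sum_congr rfl fun a _ => by rw [ih (h ++ [a]) fun r => by
      rw [List.append_assoc]; exact hF _], ← Finset.sum_mul, (hp h).2, one_mul]

theorem chainSum_const (hp : IsKernel p) (c : ℝ) (n : ℕ) (h : List α) :
    chainSum p (fun _ => c) n h = c :=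
  chainSum_eq_of_prefix hp n h fun _ => rfl

theorem chainSum_nonneg (hp : IsKernel p) {F : List α → ℝ} (n : ℕ) (h : List α)
    (hF : ∀ l, 0 ≤ F l) : 0 ≤ chainSum p F n h := by
  rw [← chainSum_const hp 0 n h]
  exact chainSum_mono (fun h a => (hp h).1 a) n h fun l _ => hF l

theorem abs_chainSum_le (hp : IsKernel p) {F : List α → ℝ} {c : ℝ} (n : ℕ) (h : List α)
    (hF : ∀ l, l.length = h.length + n → |F l| ≤ c) : |chainSum p F n h| ≤ c := by
  rw [abs_le]
  constructor
  · rw [← chainSum_const hp (-c) n h]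
    exact chainSum_mono (fun h a => (hp h).1 a) n h fun l hl => (abs_le.1 (hF l hl)).1
  · rw [← chainSum_const hp c n h]
    exact chainSum_mono (fun h a => (hp h).1 a) n h fun l hl => (abs_le.1 (hF l hl)).2

/-- A supermartingale has expectation at most its initial value. -/
theorem chainSum_le_of_step (hp : ∀ h a, 0 ≤ p h a) {G : List α → ℝ}
    (hG : ∀ h, ∑ a, p h a * G (h ++ [a]) ≤ G h) (n : ℕ) (h : List α) :
    chainSum p G n h ≤ G h := by
  induction n generalizing h with
  | zero => exact le_rfl
  | succ n ih =>
    exact (Finset.sum_le_sum fun a _ => mul_le_mul_of_nonneg_left (ih _) (hp _ _)).trans (hG h)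

/-- A supermartingale stopped at the fixed time `k`. -/
theorem chainSum_take_le_of_step (hp : IsKernel p) {G : List α → ℝ}
    (hG : ∀ h, ∑ a, p h a * G (h ++ [a]) ≤ G h) (k n : ℕ) :
    chainSum p (fun l => G (l.take k)) n [] ≤ G [] := by
  refine (chainSum_le_of_step (G := fun l => G (l.take k)) (fun h a => (hp h).1 a)
    (fun h => ?_) n []).trans (by simp)
  rcases lt_or_ge h.length k with hk | hk
  · refine le_trans (le_of_eq ?_) ((hG h).trans (by rw [List.take_of_length_le hk.le]))
    refine Finset.sum_congr rfl fun a _ => ?_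
    rw [List.take_of_length_le (by simp; omega)]
  · simp only [List.take_append_of_le_length hk]
    rw [← Finset.sum_mul, (hp h).2, one_mul]

/-- Tower property: a function `Φ` of the first `t` entries and the next one may be replaced by its
average over the next one. -/
theorem chainSum_tower (hp : IsKernel p) {F G : List α → ℝ} {Φ : List α → α → ℝ} {t : ℕ}
    (hF : ∀ h a r, h.length = t → F (h ++ a :: r) = Φ h a)
    (hG : ∀ h r, h.length = t → G (h ++ r) = ∑ a, p h a * Φ h a) (n : ℕ) (h : List α)
    (h1 : h.length ≤ t) (h2 : t < h.length + n) : chainSum p F n h = chainSum p G n h := by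
  induction n generalizing h with
  | zero => omega
  | succ n ih =>
    rcases h1.lt_or_eq with h1 | h1
    · refine Finset.sum_congr rfl fun a _ => ?_
      rw [ih _ (by simp; omega) (by simp; omega)]
    · rw [chainSum_eq_of_prefix hp (n + 1) h (hG h · h1), chainSum]
      refine Finset.sum_congr rfl fun a _ => ?_
      rw [chainSum_eq_of_prefix hp n (h ++ [a]) fun r => ?_]
      rw [List.append_assoc, List.singleton_append, hF _ _ _ h1]

/-- Simulation lemma: two kernels give expectations that differ by at most the accumulated
one-step `L¹` distance, measured along the second kernel. -/
theorem abs_chainSum_sub_le {q : List α → α → ℝ} (hp : IsKernel p) (hq : IsKernel q)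
    {F : List α → ℝ} {c : ℝ} (n : ℕ) (h : List α)
    (hF : ∀ l, l.length = h.length + n → |F l| ≤ c) :
    |chainSum p F n h - chainSum q F n h| ≤
      c * (chainSum q (prefixSum fun l => ∑ a, |p l a - q l a|) n h
        - prefixSum (fun l => ∑ a, |p l a - q l a|) h) := by
  set e : List α → ℝ := fun l => ∑ a, |p l a - q l a| with he
  induction n generalizing h with
  | zero => simp [chainSum]
  | succ n ih =>
    have hlen : ∀ (a : α) l, l.length = (h ++ [a]).length + n → |F l| ≤ c := fun a l hl =>
      hF l (by rw [hl]; simp; ring)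
    have h1 : chainSum p F (n + 1) h - chainSum q F (n + 1) h
        = ∑ a, (p h a - q h a) * chainSum p F n (h ++ [a])
          + ∑ a, q h a * (chainSum p F n (h ++ [a]) - chainSum q F n (h ++ [a])) := by
      simp only [chainSum]
      rw [← Finset.sum_sub_distrib, ← Finset.sum_add_distrib]
      exact Finset.sum_congr rfl fun a _ => by ring
    have h2 : |∑ a, (p h a - q h a) * chainSum p F n (h ++ [a])| ≤ c * e h := by
      refine (Finset.abs_sum_le_sum_abs _ _).trans ?_
      rw [he, Finset.mul_sum]
      refine Finset.sum_le_sum fun a _ => ?_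
      rw [abs_mul, mul_comm]
      exact mul_le_mul_of_nonneg_right (abs_chainSum_le hp _ _ (hlen a)) (abs_nonneg _)
    have h3 : |∑ a, q h a * (chainSum p F n (h ++ [a]) - chainSum q F n (h ++ [a]))|
        ≤ ∑ a, q h a * (c * (chainSum q (prefixSum e) n (h ++ [a]) - (prefixSum e h + e h))) := by
      refine (Finset.abs_sum_le_sum_abs _ _).trans (Finset.sum_le_sum fun a _ => ?_)
      rw [abs_mul, abs_of_nonneg ((hq h).1 a), ← prefixSum_append_singleton e h a]
      exact mul_le_mul_of_nonneg_left (ih _ (hlen a)) ((hq h).1 a)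
    have h4 : ∑ a, q h a * (c * (chainSum q (prefixSum e) n (h ++ [a]) - (prefixSum e h + e h)))
        = c * (chainSum q (prefixSum e) (n + 1) h) - c * (prefixSum e h + e h) := by
      rw [chainSum, Finset.mul_sum]
      have : c * (prefixSum e h + e h) = ∑ a, q h a * (c * (prefixSum e h + e h)) := by
        rw [← Finset.sum_mul, (hq h).2, one_mul]
      rw [this, ← Finset.sum_sub_distrib]
      exact Finset.sum_congr rfl fun a _ => by ring
    rw [h1]
    refine (abs_add_le _ _).trans ?_
    rw [h4] at h3
    linarith

end Chain

/-! ### Newton interpolation of mixtures of products -/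

section Newton

variable {ι κ : Type} [DecidableEq ι] [DecidableEq κ]

/-- Newton interpolation on finitely many atoms. A signed combination, over the atoms `i ∈ I`, of
products `∏ t ∈ U, y i t` is controlled by the same combinations of products over subsets `B ⊆ U`
of size less than `|I|`, weighted by products of the remaining factors at prescribed atoms. The
family of pairs `(B, j)` depends neither on the factors `y` nor on the weights `g`. -/
theorem exists_newton_family (U : Finset κ) (I : Finset ι) :
    ∃ Fam : List (Finset κ × (κ → ι)),
      Fam.length ≤ 3 ^ U.card ∧ Fam.length ≤ (1 + 2 * U.card) ^ I.card ∧
      (∀ f ∈ Fam, f.1 ⊆ U ∧ f.1.card < I.card) ∧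
      ∀ (y : ι → κ → ℝ) (g : ι → ℝ), (∀ i t, 0 ≤ y i t) →
        |∑ i ∈ I, g i * ∏ t ∈ U, y i t| ≤
          (Fam.map fun f =>
            (∏ t ∈ U \ f.1, y (f.2 t) t) * |∑ i ∈ I, g i * ∏ t ∈ f.1, y i t|).sum := by
  induction U using Finset.induction_on generalizing I with
  | empty =>
    rcases I.eq_empty_or_nonempty with rfl | ⟨j, hj⟩
    · exact ⟨[], by simp⟩
    · exact ⟨[(∅, fun _ => j)], by simp, by simp, by simpa using ⟨j, hj⟩, by simp⟩
  | insert t U ht ih =>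
    rcases I.eq_empty_or_nonempty with rfl | ⟨j, hj⟩
    · exact ⟨[], by simp⟩
    obtain ⟨F₁, h1, h1', h1s, h1b⟩ := ih I
    obtain ⟨F₂, h2, h2', h2s, h2b⟩ := ih (I.erase j)
    have hcard : (I.erase j).card + 1 = I.card := Finset.card_erase_add_one hj
    refine ⟨F₁.map (fun f => (f.1, Function.update f.2 t j)) ++
      (F₂.map (fun f => (insert t f.1, f.2)) ++
        F₂.map (fun f => (f.1, Function.update f.2 t j))), ?_, ?_, ?_, ?_⟩
    · simp only [List.length_append, List.length_map, Finset.card_insert_of_notMem ht, pow_succ]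
      omega
    · simp only [List.length_append, List.length_map, Finset.card_insert_of_notMem ht]
      rw [← hcard] at h1' ⊢
      have h3 : (1 + 2 * U.card) ^ (I.erase j).card ≤ (1 + 2 * (U.card + 1)) ^ (I.erase j).card :=
        Nat.pow_le_pow_left (by omega) _
      rw [pow_succ] at h1' ⊢
      nlinarith
    · intro f hf
      simp only [List.mem_append, List.mem_map] at hf
      rcases hf with ⟨f, hf, rfl⟩ | ⟨f, hf, rfl⟩ | ⟨f, hf, rfl⟩
      · exact ⟨(h1s f hf).1.trans (Finset.subset_insert _ _), (h1s f hf).2⟩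
      · refine ⟨Finset.insert_subset_insert _ (h2s f hf).1, ?_⟩
        have := (h2s f hf).2
        have := Finset.card_insert_le t f.1
        simp only
        omega
      · refine ⟨(h2s f hf).1.trans (Finset.subset_insert _ _), ?_⟩
        have := (h2s f hf).2
        simp only
        omega
    · intro y g hy
      have hprod : ∀ f : Finset κ × (κ → ι), f.1 ⊆ U →
          ∏ s ∈ insert t U \ f.1, y (Function.update f.2 t j s) s
            = y j t * ∏ s ∈ U \ f.1, y (f.2 s) s := by
        intro f hf
        have htf : t ∉ f.1 := fun h => ht (hf h)
        rw [Finset.insert_sdiff_of_notMem _ htf, Finset.prod_insert (by simp [ht])]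
        simp only [Function.update_self]
        congr 1
        refine Finset.prod_congr rfl fun s hs => ?_
        rw [Function.update_of_ne]
        rintro rfl
        exact ht (Finset.mem_sdiff.1 hs).1
      -- the factor at `t` is split as `y i t = y j t + (y i t - y j t)`; the second part
      -- kills atom `j`
      have hsplit : ∑ i ∈ I, g i * ∏ s ∈ insert t U, y i s
          = y j t * ∑ i ∈ I, g i * ∏ s ∈ U, y i s
            + ∑ i ∈ I.erase j, (g i * (y i t - y j t)) * ∏ s ∈ U, y i s := by
        rw [← Finset.add_sum_erase I _ hj,
          ← Finset.add_sum_erase I (fun i => g i * ∏ s ∈ U, y i s) hj, mul_add, Finset.mul_sum,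
          add_assoc, ← Finset.sum_add_distrib]
        simp only [Finset.prod_insert ht]
        congr 1
        · ring
        · exact Finset.sum_congr rfl fun i _ => by ring
      have hA := mul_le_mul_of_nonneg_left (h1b y g hy) (hy j t)
      have hB := h2b y (fun i => g i * (y i t - y j t)) hy
      rw [hsplit]
      refine (abs_add_le _ _).trans ?_
      rw [abs_mul, abs_of_nonneg (hy j t)]
      refine (add_le_add hA hB).trans ?_
      rw [List.map_append, List.sum_append, List.map_append, List.sum_append, List.map_map,
        List.map_map, List.map_map, ← List.sum_map_mul_left, ← List.sum_map_add]
      refine add_le_add (le_of_eq ?_) (List.sum_le_sum fun f hf => ?_)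
      · congr 1
        refine List.map_congr_left fun f hf => ?_
        simp only [Function.comp]
        rw [hprod f (h1s f hf).1, mul_assoc]
      · have hfU := (h2s f hf).1
        have htf : t ∉ f.1 := fun h => ht (hfU h)
        simp only [Function.comp]
        rw [hprod f hfU]
        have hsd : insert t U \ insert t f.1 = U \ f.1 := by
          ext s
          simp only [Finset.mem_sdiff, Finset.mem_insert]
          constructor
          · rintro ⟨rfl | h, h'⟩
            · exact absurd (Or.inl rfl) h'
            · exact ⟨h, fun hh => h' (Or.inr hh)⟩
          · rintro ⟨h, h'⟩
            refine ⟨Or.inr h, ?_⟩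
            rintro (rfl | h'')
            · exact ht h
            · exact h' h''
        rw [hsd]
        have hP : 0 ≤ ∏ s ∈ U \ f.1, y (f.2 s) s := Finset.prod_nonneg fun s _ => hy _ _
        have hsum : ∑ i ∈ I.erase j, g i * (y i t - y j t) * ∏ s ∈ f.1, y i s
            = (∑ i ∈ I, g i * ∏ s ∈ insert t f.1, y i s)
              - y j t * ∑ i ∈ I, g i * ∏ s ∈ f.1, y i s := by
          rw [Finset.mul_sum, ← Finset.sum_sub_distrib, ← Finset.add_sum_erase I _ hj]
          simp only [Finset.prod_insert htf]
          rw [mul_left_comm, sub_self, zero_add]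
          exact Finset.sum_congr rfl fun i _ => by ring
        rw [hsum, mul_assoc, mul_left_comm, ← mul_add]
        refine mul_le_mul_of_nonneg_left ?_ hP
        refine (abs_sub _ _).trans ?_
        rw [abs_mul, abs_of_nonneg (hy j t)]

end Newton

/-! ### Trajectories as chains -/

section Kernels

variable {S A : Type} {𝒵 : Finset ℝ} {M H : ℕ}

/-- The state-action pair of a (state, action, reward) triple. -/
def sa (y : S × A × 𝒵) : S × A := (y.1, y.2.1)

/-- The policy that plays by a rule depending on past states and actions only. -/
def ignoreRewards (g : List (S × A) → S → A) : Policy S A 𝒵 := fun l s => g (l.map sa) s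

open Classical in
/-- Kernel on state-action pairs: the state is drawn from `P`, the action is played by `g`. -/
def saKernel (P : List (S × A) → S → ℝ) (g : List (S × A) → S → A)
    (l : List (S × A)) (x : S × A) : ℝ :=
  P l x.1 * if x.2 = g l x.1 then 1 else 0

open Classical in
/-- Kernel on (state, action, reward) triples: the state is drawn from `P`, the action is played by
the policy `π` and the reward is drawn from `q`. -/
def stepKernel (P : List (S × A) → S → ℝ) (π : Policy S A 𝒵)
    (q : List (S × A × 𝒵) → S × A → 𝒵 → ℝ) (l : List (S × A × 𝒵)) (y : S × A × 𝒵) : ℝ :=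
  P (l.map sa) y.1 * (if y.2.1 = π l y.1 then 1 else 0) * q l (sa y) y.2.2

variable [Fintype S] [Fintype A]

/-- The law of the next state given the past state-action pairs of the episode. -/
def stateKernel (𝓜 : RMMDP S A 𝒵 M) (l : List (S × A)) : S → ℝ :=
  l.getLast?.elim 𝓜.ν fun x => 𝓜.T x.1 x.2

theorem stateKernel_mem (𝓜 : RMMDP S A 𝒵 M) (l : List (S × A)) :
    stateKernel 𝓜 l ∈ stdSimplex ℝ S := by
  unfold stateKernel
  cases l.getLast? with
  | none => exact 𝓜.ν_mem
  | some x => exact 𝓜.T_mem _ _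

/-- The reward kernel of latent context `m`. -/
def rewardKernel (𝓜 : RMMDP S A 𝒵 M) (m : Fin M) :
    List (S × A × 𝒵) → S × A → 𝒵 → ℝ :=
  fun _ x => 𝓜.μ m x.1 x.2

theorem stateProb_eq (𝓜 : RMMDP S A 𝒵 M) (τ : Trajectory S A 𝒵 H) (t : Fin H) :
    𝓜.stateProb τ t = stateKernel 𝓜 ((past τ t).map sa) (τ t).1 := by
  unfold RMMDP.stateProb stateKernel past
  have ht := t.2
  split_ifs with h
  · simp [h]
  · rw [List.getLast?_eq_getElem?]
    have h1 : ((List.take (↑t) (List.ofFn τ)).map sa).length - 1 = (t : ℕ) - 1 := by simp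
    have h2 : (t : ℕ) - 1 < H := by omega
    have h3 : (t : ℕ) - 1 < t := by omega
    rw [h1, List.getElem?_map, List.getElem?_take_of_lt h3, List.getElem?_ofFn, dif_pos h2]
    rfl

/-- Given the latent context the trajectory is a chain, so the law of a trajectory is a mixture of
chains. -/
theorem trajProb_eq (𝓜 : RMMDP S A 𝒵 M) (π : Policy S A 𝒵) (τ : Trajectory S A 𝒵 H) :
    𝓜.trajProb π τ = ∑ m, 𝓜.w m *
      ∏ t, stepKernel (stateKernel 𝓜) π (rewardKernel 𝓜 m) (past τ t) (τ t) := by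
  unfold RMMDP.trajProb RMMDP.rewardProb
  rw [Finset.mul_sum]
  refine Finset.sum_congr rfl fun m _ => ?_
  unfold stepKernel RMMDP.actionProb rewardKernel sa
  simp only [Finset.prod_mul_distrib, stateProb_eq]
  unfold sa
  ring

theorem sum_trajProb_mul (𝓜 : RMMDP S A 𝒵 M) (π : Policy S A 𝒵) (F : List (S × A × 𝒵) → ℝ) :
    ∑ τ : Trajectory S A 𝒵 H, 𝓜.trajProb π τ * F (List.ofFn τ)
      = ∑ m, 𝓜.w m *
        chainSum (stepKernel (stateKernel 𝓜) π (rewardKernel 𝓜 m)) F H [] := by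
  simp only [trajProb_eq, ← sum_prod_past, Finset.sum_mul, Finset.mul_sum]
  rw [Finset.sum_comm]
  exact Finset.sum_congr rfl fun m _ => Finset.sum_congr rfl fun τ _ => by ring

theorem sum_saKernel_mul (P : List (S × A) → S → ℝ) (g : List (S × A) → S → A)
    (l : List (S × A)) (c : S × A → ℝ) :
    ∑ x, saKernel P g l x * c x = ∑ s, P l s * c (s, g l s) := by
  classical
  rw [Fintype.sum_prod_type]
  refine Finset.sum_congr rfl fun s _ => ?_
  simp only [saKernel]
  rw [Finset.sum_eq_single (g l s)]
  · simp
  · intro a _ ha; simp [ha]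
  · simp

theorem sum_stepKernel_mul (P : List (S × A) → S → ℝ) (π : Policy S A 𝒵)
    (q : List (S × A × 𝒵) → S × A → 𝒵 → ℝ) (l : List (S × A × 𝒵)) (c : S × A × 𝒵 → ℝ) :
    ∑ y, stepKernel P π q l y * c y
      = ∑ s, P (l.map sa) s * ∑ z, q l (s, π l s) z * c (s, π l s, z) := by
  classical
  rw [Fintype.sum_prod_type]
  refine Finset.sum_congr rfl fun s _ => ?_
  rw [Fintype.sum_prod_type, Finset.sum_eq_single (π l s)]
  · rw [Finset.mul_sum]
    refine Finset.sum_congr rfl fun z _ => ?_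
    simp [stepKernel, sa, mul_assoc]
  · intro a _ ha; simp [stepKernel, ha]
  · simp

theorem isKernel_saKernel {P : List (S × A) → S → ℝ} (hP : ∀ l, P l ∈ stdSimplex ℝ S)
    (g : List (S × A) → S → A) : IsKernel (saKernel P g) := by
  intro l
  constructor
  · intro x
    unfold saKernel
    have := (hP l).1 x.1
    split_ifs <;> simp [this]
  · simpa [(hP l).2] using sum_saKernel_mul P g l fun _ => 1

theorem isKernel_stepKernel {P : List (S × A) → S → ℝ} (hP : ∀ l, P l ∈ stdSimplex ℝ S)
    (π : Policy S A 𝒵) {q : List (S × A × 𝒵) → S × A → 𝒵 → ℝ}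
    (hq : ∀ l x, q l x ∈ stdSimplex ℝ 𝒵) : IsKernel (stepKernel P π q) := by
  intro l
  constructor
  · intro y
    unfold stepKernel
    have h1 := (hP (l.map sa)).1 y.1
    have h2 := (hq l (sa y)).1 y.2.2
    split_ifs
    · simpa using mul_nonneg h1 h2
    · simp
  · have := sum_stepKernel_mul P π q l fun _ => 1
    simp only [mul_one, (hq _ _).2, (hP _).2] at this
    exact this

theorem rewardKernel_mem (𝓜 : RMMDP S A 𝒵 M) (m : Fin M) (l : List (S × A × 𝒵)) (x : S × A) :
    rewardKernel 𝓜 m l x ∈ stdSimplex ℝ 𝒵 := 𝓜.μ_mem _ _ _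

theorem trajProb_nonneg (𝓜 : RMMDP S A 𝒵 M) (π : Policy S A 𝒵) (τ : Trajectory S A 𝒵 H) :
    0 ≤ 𝓜.trajProb π τ := by
  rw [trajProb_eq]
  exact Finset.sum_nonneg fun m _ => mul_nonneg (𝓜.w_mem.1 m) <| Finset.prod_nonneg fun t _ =>
    (isKernel_stepKernel (stateKernel_mem 𝓜) π (rewardKernel_mem 𝓜 m) _).1 _

theorem sum_trajProb (𝓜 : RMMDP S A 𝒵 M) (π : Policy S A 𝒵) :
    ∑ τ : Trajectory S A 𝒵 H, 𝓜.trajProb π τ = 1 := by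
  have := sum_trajProb_mul (H := H) 𝓜 π fun _ => 1
  simp only [mul_one] at this
  rw [this]
  simp only [chainSum_const (isKernel_stepKernel (stateKernel_mem 𝓜) π (rewardKernel_mem 𝓜 _)),
    mul_one]
  exact 𝓜.w_mem.2

theorem chainSum_stepKernel_ignoreRewards (P : List (S × A) → S → ℝ) (g : List (S × A) → S → A)
    {q : List (S × A × 𝒵) → S × A → 𝒵 → ℝ} (hq : ∀ l x, q l x ∈ stdSimplex ℝ 𝒵)
    (F : List (S × A) → ℝ) (n : ℕ) (h : List (S × A × 𝒵)) :
    chainSum (stepKernel P (ignoreRewards g) q) (fun l => F (l.map sa)) n h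
      = chainSum (saKernel P g) F n (h.map sa) := by
  induction n generalizing h with
  | zero => rfl
  | succ n ih =>
    simp only [chainSum]
    rw [sum_stepKernel_mul, sum_saKernel_mul]
    refine Finset.sum_congr rfl fun s _ => ?_
    congr 1
    simp only [ih, List.map_append, List.map_cons, List.map_nil, sa]
    rw [← Finset.sum_mul, (hq _ _).2, one_mul]
    rfl

/-- Under a policy that ignores rewards, the state-action pairs form a chain. -/
theorem sum_trajProb_ignoreRewards_mul (𝓜 : RMMDP S A 𝒵 M) (g : List (S × A) → S → A)
    (F : List (S × A) → ℝ) :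
    ∑ τ : Trajectory S A 𝒵 H, 𝓜.trajProb (ignoreRewards g) τ * F (List.ofFn fun t => sa (τ t))
      = chainSum (saKernel (stateKernel 𝓜) g) F H [] := by
  have h := sum_trajProb_mul (H := H) 𝓜 (ignoreRewards g) fun l => F (l.map sa)
  simp only [List.map_ofFn] at h
  refine Eq.trans h ?_
  simp only [chainSum_stepKernel_ignoreRewards _ _ (rewardKernel_mem 𝓜 _), List.map_nil]
  rw [← Finset.sum_mul, 𝓜.w_mem.2, one_mul]

/-! ### Planning with respect to state-action pairs -/

/-- Optimal expected value of `F` (a function of the list of state-action pairs) when `n` steps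
remain after `h` and the states are drawn from `P`. -/
def optSum (P : List (S × A) → S → ℝ) (F : List (S × A) → ℝ) : ℕ → List (S × A) → ℝ
  | 0, h => F h
  | n + 1, h => ∑ s, P h s * ⨆ a, optSum P F n (h ++ [(s, a)])

/-- No policy does better than `optSum`, even if it uses rewards produced by an arbitrary kernel
that depends on the whole history. -/
theorem chainSum_stepKernel_le_optSum {P : List (S × A) → S → ℝ} (hP : ∀ l, P l ∈ stdSimplex ℝ S)
    (π : Policy S A 𝒵) {q : List (S × A × 𝒵) → S × A → 𝒵 → ℝ}
    (hq : ∀ l x, q l x ∈ stdSimplex ℝ 𝒵) (F : List (S × A) → ℝ) (n : ℕ) (h : List (S × A × 𝒵)) :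
    chainSum (stepKernel P π q) (fun l => F (l.map sa)) n h ≤ optSum P F n (h.map sa) := by
  induction n generalizing h with
  | zero => exact le_rfl
  | succ n ih =>
    simp only [chainSum, optSum]
    rw [sum_stepKernel_mul]
    refine Finset.sum_le_sum fun s _ => mul_le_mul_of_nonneg_left ?_ ((hP _).1 s)
    have hle : ∀ z, chainSum (stepKernel P π q) (fun l => F (l.map sa)) n (h ++ [(s, π h s, z)])
        ≤ ⨆ a, optSum P F n (h.map sa ++ [(s, a)]) := by
      intro z
      refine (ih _).trans ?_
      rw [List.map_append]
      exact le_ciSup (f := fun a => optSum P F n (h.map sa ++ [(s, a)]))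
        (Set.finite_range _).bddAbove (π h s)
    refine (Finset.sum_le_sum fun z _ =>
      mul_le_mul_of_nonneg_left (hle z) ((hq _ _).1 z)).trans (le_of_eq ?_)
    rw [← Finset.sum_mul, (hq _ _).2, one_mul]

theorem chainSum_saKernel_le_optSum {P : List (S × A) → S → ℝ} (hP : ∀ l, P l ∈ stdSimplex ℝ S)
    (g : List (S × A) → S → A) (F : List (S × A) → ℝ) (n : ℕ) (h : List (S × A)) :
    chainSum (saKernel P g) F n h ≤ optSum P F n h := by
  induction n generalizing h with
  | zero => exact le_rfl
  | succ n ih =>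
    simp only [chainSum, optSum]
    rw [sum_saKernel_mul]
    refine Finset.sum_le_sum fun s _ => mul_le_mul_of_nonneg_left ?_ ((hP _).1 s)
    exact (ih _).trans (le_ciSup (f := fun a => optSum P F n (h ++ [(s, a)]))
      (Set.finite_range _).bddAbove (g h s))

/-- The optimal value of a planning problem with `H` steps is attained. -/
theorem exists_chainSum_eq_optSum [Nonempty A] (P : List (S × A) → S → ℝ)
    (F : List (S × A) → ℝ) (H : ℕ) :
    ∃ g : List (S × A) → S → A, chainSum (saKernel P g) F H [] = optSum P F H [] := by
  have hex : ∀ (h : List (S × A)) (s : S), ∃ a, optSum P F (H - h.length - 1) (h ++ [(s, a)])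
      = ⨆ a, optSum P F (H - h.length - 1) (h ++ [(s, a)]) := fun h s =>
    exists_eq_ciSup_of_finite
  choose g hg using hex
  refine ⟨g, ?_⟩
  have key : ∀ n (h : List (S × A)), h.length + n = H →
      chainSum (saKernel P g) F n h = optSum P F n h := by
    intro n
    induction n with
    | zero => intro h _; rfl
    | succ n ih =>
      intro h hh
      simp only [chainSum, optSum]
      rw [sum_saKernel_mul]
      refine Finset.sum_congr rfl fun s _ => ?_
      have hn : H - h.length - 1 = n := by omega
      rw [ih _ (by simp; omega), ← hn, hg]
  exact key H [] (by simp)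

theorem sum_abs_saKernel_sub (P Q : List (S × A) → S → ℝ) (g : List (S × A) → S → A)
    (l : List (S × A)) :
    ∑ x, |saKernel P g l x - saKernel Q g l x| = ∑ s, |P l s - Q l s| := by
  have : ∀ x, |saKernel P g l x - saKernel Q g l x|
      = saKernel (fun l s => |P l s - Q l s|) g l x * 1 := by
    intro x
    unfold saKernel
    split_ifs <;> simp
  simp only [this]
  rw [sum_saKernel_mul]
  simp

theorem sum_abs_stepKernel_sub (P Q : List (S × A) → S → ℝ) (π : Policy S A 𝒵)
    {q : List (S × A × 𝒵) → S × A → 𝒵 → ℝ} (hq : ∀ l x, q l x ∈ stdSimplex ℝ 𝒵)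
    (l : List (S × A × 𝒵)) :
    ∑ y, |stepKernel P π q l y - stepKernel Q π q l y|
      = ∑ s, |P (l.map sa) s - Q (l.map sa) s| := by
  have : ∀ y, |stepKernel P π q l y - stepKernel Q π q l y|
      = stepKernel (fun l s => |P l s - Q l s|) π q l y * 1 := by
    intro y
    have := (hq l (sa y)).1 y.2.2
    unfold stepKernel
    split_ifs
    · rw [← sub_mul, abs_mul, abs_of_nonneg this]; simp
    · simp
  simp only [this]
  rw [sum_stepKernel_mul]
  simp only [mul_one, (hq _ _).2]

end Kernels

/-! ### Features of trajectories and their conditional laws -/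

section Features

variable {S A : Type} {𝒵 : Finset ℝ} {M H : ℕ}

open Classical in
/-- The indicator `0` or `1` of a proposition. -/
def ind (p : Prop) : ℝ := if p then 1 else 0

theorem ind_pos {p : Prop} (h : p) : ind p = 1 := if_pos h

theorem ind_neg {p : Prop} (h : ¬p) : ind p = 0 := if_neg h

theorem ind_nonneg (p : Prop) : 0 ≤ ind p := by unfold ind; split_ifs <;> norm_num

theorem ind_le_one (p : Prop) : ind p ≤ 1 := by unfold ind; split_ifs <;> norm_num

open Classical in
/-- Number of entries of a list with a given property. -/
def cnt {α : Type} (p : α → Prop) (l : List α) : ℕ := l.countP fun a => p a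

theorem cnt_append_singleton {α : Type} (p : α → Prop) (l : List α) (a : α) :
    (cnt p (l ++ [a]) : ℝ) = cnt p l + ind (p a) := by
  unfold cnt ind
  rw [List.countP_append, List.countP_singleton]
  split_ifs <;> simp_all

theorem cnt_nil {α : Type} (p : α → Prop) : cnt p [] = 0 := by simp [cnt]

theorem cnt_le_length {α : Type} (p : α → Prop) (l : List α) : cnt p l ≤ l.length :=
  List.countP_le_length

/-- The event that the state-action pairs of `τ` at the times in `B` are `k`. -/
def SAEvent (B : Finset (Fin H)) (k : B → S × A) (τ : Trajectory S A 𝒵 H) : Prop :=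
  B.restrict (fun t => sa (τ t)) = k

/-- The event that the rewards of `τ` at the times in `B` are `z`. -/
def RewardEvent (B : Finset (Fin H)) (z : B → 𝒵) (τ : Trajectory S A 𝒵 H) : Prop :=
  B.restrict (fun t => (τ t).2.2) = z

/-- The event that the state of `τ` at time `t` is `s`. -/
def StateEvent (t : Fin H) (s : S) (τ : Trajectory S A 𝒵 H) : Prop := (τ t).1 = s

/-- The singleton of the time preceding `t`; it is empty for the first time. -/
def prevSet (t : Fin H) : Finset (Fin H) := Finset.univ.filter fun u => (u : ℕ) + 1 = t

/-- Entries of a list as a function on `Fin H`, with a default value beyond the end of the list. -/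
def entries {α : Type} (x₀ : α) (l : List α) : Fin H → α := fun t => l.getD t x₀

theorem entries_ofFn {α : Type} (x₀ : α) (x : Fin H → α) : entries x₀ (List.ofFn x) = x := by
  ext t
  simp [entries]

theorem restrict_prevSet_entries {α : Type} (x₀ : α) (t : Fin H) (h r : List α)
    (ht : h.length = t) :
    (prevSet t).restrict (entries x₀ (h ++ r)) = (prevSet t).restrict (entries x₀ h) := by
  ext ⟨u, hu⟩
  have hu' := (Finset.mem_filter.1 hu).2
  simp only [Finset.restrict, entries]
  rw [List.getD_append _ _ _ _ (by omega)]

/-- Trajectories as pairs of state-action sequences and reward sequences. -/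
def trajEquiv : (Fin H → S × A) × (Fin H → 𝒵) ≃ Trajectory S A 𝒵 H where
  toFun p t := ((p.1 t).1, (p.1 t).2, p.2 t)
  invFun τ := (fun t => sa (τ t), fun t => (τ t).2.2)
  left_inv _ := rfl
  right_inv _ := rfl

variable [Fintype S] [Fintype A]

/-- Joint probability of the rewards `z` at the state-action pairs `k`. -/
def moment (𝓜 : RMMDP S A 𝒵 M) {B : Finset (Fin H)} (k : B → S × A) (z : B → 𝒵) : ℝ :=
  ∑ m, 𝓜.w m * ∏ t, 𝓜.μ m (k t).1 (k t).2 (z t)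

/-- Probability of the state at time `t` given the state-action pair `k` at the preceding time. -/
def transProb (𝓜 : RMMDP S A 𝒵 M) (t : Fin H) (k : prevSet t → S × A) : S → ℝ :=
  if h : 0 < (t : ℕ) then
    Function.uncurry 𝓜.T (k ⟨⟨t - 1, by omega⟩, by simp [prevSet]; omega⟩)
  else 𝓜.ν

theorem transProb_mem (𝓜 : RMMDP S A 𝒵 M) (t : Fin H) (k : prevSet t → S × A) :
    transProb 𝓜 t k ∈ stdSimplex ℝ S := by
  unfold transProb
  split_ifs
  · exact 𝓜.T_mem _ _
  · exact 𝓜.ν_mem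

theorem stateKernel_eq_transProb (𝓜 : RMMDP S A 𝒵 M) (x₀ : S × A) (t : Fin H)
    (h : List (S × A)) (ht : h.length = t) :
    stateKernel 𝓜 h = transProb 𝓜 t ((prevSet t).restrict (entries x₀ h)) := by
  unfold stateKernel transProb
  rw [List.getLast?_eq_getElem?, ht]
  split_ifs with h0
  · have h1 : (t : ℕ) - 1 < h.length := by omega
    rw [List.getElem?_eq_getElem h1]
    simp [Finset.restrict, entries, List.getElem?_eq_getElem h1, Function.uncurry]
  · have : h = [] := List.eq_nil_of_length_eq_zero (by omega)
    simp [this]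

theorem moment_nonneg (𝓜 : RMMDP S A 𝒵 M) {B : Finset (Fin H)} (k : B → S × A) (z : B → 𝒵) :
    0 ≤ moment 𝓜 k z :=
  Finset.sum_nonneg fun m _ => mul_nonneg (𝓜.w_mem.1 m) <| Finset.prod_nonneg fun _ _ =>
    (𝓜.μ_mem _ _ _).1 _

theorem moment_le_one (𝓜 : RMMDP S A 𝒵 M) {B : Finset (Fin H)} (k : B → S × A) (z : B → 𝒵) :
    moment 𝓜 k z ≤ 1 := by
  rw [← 𝓜.w_mem.2]
  refine Finset.sum_le_sum fun m _ => mul_le_of_le_one_right (𝓜.w_mem.1 m) ?_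
  exact Finset.prod_le_one (fun t _ => (𝓜.μ_mem _ _ _).1 _) fun t _ =>
    (mem_Icc_of_mem_stdSimplex (𝓜.μ_mem _ _ _) _).2

theorem sum_prod_mul_restrict_eq {ι β : Type} [Fintype ι] [DecidableEq ι] [Fintype β]
    (f : ι → β → ℝ)
    (hf : ∀ i, ∑ b, f i b = 1) (B : Finset ι) (z : B → β) :
    ∑ x : ι → β, (∏ i, f i (x i)) * ind (B.restrict x = z) = ∏ i : B, f i (z i) := by
  classical
  have h1 : ∀ x : ι → β, ind (B.restrict x = z)
      = ∏ i, (if h : i ∈ B then ind (x i = z ⟨i, h⟩) else 1) := by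
    intro x
    by_cases hx : B.restrict x = z
    · rw [ind_pos hx]
      refine (Finset.prod_eq_one fun i _ => ?_).symm
      split_ifs with h1
      · exact ind_pos (congrFun hx ⟨i, h1⟩)
      · rfl
    · rw [ind_neg hx]
      obtain ⟨i, hi⟩ := Function.ne_iff.1 hx
      refine (Finset.prod_eq_zero (Finset.mem_univ (i : ι)) ?_).symm
      rw [dif_pos i.2]
      exact ind_neg hi
  simp only [h1, ← Finset.prod_mul_distrib]
  rw [← Fintype.piFinset_univ, ← Finset.prod_univ_sum (fun _ => Finset.univ)
    (fun i b => f i b * (if h : i ∈ B then ind (b = z ⟨i, h⟩) else 1))]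
  have h2 : ∀ i, ∑ b, f i b * (if h : i ∈ B then ind (b = z ⟨i, h⟩) else 1)
      = if h : i ∈ B then f i (z ⟨i, h⟩) else 1 := by
    intro i
    split_ifs with h
    · simp [ind]
    · simp [hf]
  simp only [h2]
  rw [← Finset.prod_subset (Finset.subset_univ B) (fun i _ hi => dif_neg hi), ← Finset.prod_attach]
  refine Finset.prod_congr rfl fun i _ => ?_
  rw [dif_pos i.2]

theorem trajProb_ignoreRewards (𝓜 : RMMDP S A 𝒵 M) (g : List (S × A) → S → A)
    (x : Fin H → S × A) (z : Fin H → 𝒵) :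
    𝓜.trajProb (ignoreRewards g) (trajEquiv (x, z))
      = (∏ t, saKernel (stateKernel 𝓜) g (past x t) (x t))
        * ∑ m, 𝓜.w m * ∏ t, 𝓜.μ m (x t).1 (x t).2 (z t) := by
  rw [trajProb_eq, Finset.mul_sum]
  refine Finset.sum_congr rfl fun m _ => ?_
  rw [mul_left_comm, ← Finset.prod_mul_distrib]
  congr 1
  refine Finset.prod_congr rfl fun t _ => ?_
  unfold stepKernel saKernel ignoreRewards
  rw [map_past]
  rfl

/-- Under a policy that ignores rewards, the rewards at the times in `B` have the joint law `moment`
given the state-action pairs at these times. This fails for policies that react to rewards, since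
the actions then carry information about the latent context. -/
theorem sum_trajProb_rewardEvent (𝓜 : RMMDP S A 𝒵 M) (g : List (S × A) → S → A)
    (B : Finset (Fin H)) (k : B → S × A) (z : B → 𝒵) :
    ∑ τ : Trajectory S A 𝒵 H, 𝓜.trajProb (ignoreRewards g) τ *
        ind (SAEvent B k τ ∧ RewardEvent B z τ)
      = moment 𝓜 k z * ∑ τ : Trajectory S A 𝒵 H, 𝓜.trajProb (ignoreRewards g) τ *
        ind (SAEvent B k τ) := by
  rw [← trajEquiv.sum_comp, ← trajEquiv.sum_comp, Fintype.sum_prod_type, Fintype.sum_prod_type,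
    Finset.mul_sum]
  refine Finset.sum_congr rfl fun x _ => ?_
  simp only [trajProb_ignoreRewards]
  have hS : ∀ z' : Fin H → 𝒵, SAEvent B k (trajEquiv (x, z')) ↔ B.restrict x = k := fun _ => Iff.rfl
  have hR : ∀ z' : Fin H → 𝒵, RewardEvent B z (trajEquiv (x, z')) ↔ B.restrict z' = z :=
    fun _ => Iff.rfl
  simp only [hS, hR]
  set W := ∏ t, saKernel (stateKernel 𝓜) g (past x t) (x t)
  by_cases hx : B.restrict x = k
  · simp only [hx, true_and, ind_pos, mul_one]
    have h1 : ∀ m, ∑ z' : Fin H → 𝒵, ∏ t, 𝓜.μ m (x t).1 (x t).2 (z' t) = 1 := by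
      intro m
      rw [← Fintype.piFinset_univ, ← Finset.prod_univ_sum (fun _ => Finset.univ)
        (fun t b => 𝓜.μ m (x t).1 (x t).2 b)]
      exact Finset.prod_eq_one fun t _ => (𝓜.μ_mem _ _ _).2
    have h2 : ∑ z' : Fin H → 𝒵, W * ∑ m, 𝓜.w m * ∏ t, 𝓜.μ m (x t).1 (x t).2 (z' t) = W := by
      rw [← Finset.mul_sum, Finset.sum_comm]
      simp only [← Finset.mul_sum, h1, mul_one, 𝓜.w_mem.2]
    rw [h2]
    have h3 : ∑ z' : Fin H → 𝒵, (W * ∑ m, 𝓜.w m * ∏ t, 𝓜.μ m (x t).1 (x t).2 (z' t))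
          * ind (B.restrict z' = z)
        = W * ∑ m, 𝓜.w m * ∑ z' : Fin H → 𝒵, (∏ t, 𝓜.μ m (x t).1 (x t).2 (z' t))
          * ind (B.restrict z' = z) := by
      simp only [mul_assoc, Finset.sum_mul, ← Finset.mul_sum]
      congr 1
      rw [Finset.sum_comm]
      simp only [Finset.mul_sum]
    rw [h3, mul_comm]
    congr 1
    refine Finset.sum_congr rfl fun m _ => ?_
    rw [sum_prod_mul_restrict_eq (fun t b => 𝓜.μ m (x t).1 (x t).2 b) fun t => (𝓜.μ_mem _ _ _).2]
    simp only [← hx, Finset.restrict]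
  · simp [hx, ind]

/-- The state at time `t` is distributed according to the transition law given the preceding
state-action pair. -/
theorem sum_trajProb_stateEvent [Nonempty S] [Nonempty A] (𝓜 : RMMDP S A 𝒵 M)
    (g : List (S × A) → S → A) (t : Fin H) (k : prevSet t → S × A) (s : S) :
    ∑ τ : Trajectory S A 𝒵 H, 𝓜.trajProb (ignoreRewards g) τ *
        ind (SAEvent (prevSet t) k τ ∧ StateEvent t s τ)
      = transProb 𝓜 t k s * ∑ τ : Trajectory S A 𝒵 H, 𝓜.trajProb (ignoreRewards g) τ *
        ind (SAEvent (prevSet t) k τ) := by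
  obtain ⟨x₀⟩ : Nonempty (S × A) := inferInstance
  have e1 := sum_trajProb_ignoreRewards_mul (H := H) 𝓜 g fun l =>
    ind ((prevSet t).restrict (entries x₀ l) = k ∧ (entries (H := H) x₀ l t).1 = s)
  have e2 := sum_trajProb_ignoreRewards_mul (H := H) 𝓜 g fun l => transProb 𝓜 t k s *
    ind ((prevSet t).restrict (entries x₀ l) = k)
  simp only [entries_ofFn] at e1 e2
  refine e1.trans (Eq.trans ?_ (e2.symm.trans ?_))
  · refine chainSum_tower (isKernel_saKernel (stateKernel_mem 𝓜) g) (t := t)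
      (Φ := fun h x => ind ((prevSet t).restrict (entries x₀ h) = k ∧ x.1 = s))
      ?_ ?_ H [] (by simp) (by simp)
    · intro h a r hh
      rw [restrict_prevSet_entries _ _ _ _ hh]
      have : entries (H := H) x₀ (h ++ a :: r) t = a := by
        simp [entries, List.getD_eq_getElem?_getD, ← hh]
      rw [this]
    · intro h r hh
      rw [restrict_prevSet_entries _ _ _ _ hh, sum_saKernel_mul]
      by_cases hk : (prevSet t).restrict (entries x₀ h) = k
      · classical
        simp only [hk, true_and, ind, if_true, mul_one, mul_ite, mul_zero, Finset.sum_ite_eq',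
          Finset.mem_univ]
        rw [stateKernel_eq_transProb 𝓜 x₀ t h hh, hk]
      · simp [hk, ind]
  · rw [Finset.mul_sum]
    exact Finset.sum_congr rfl fun τ _ => mul_left_comm _ _ _

end Features

/-! ### Concentration and the pigeonhole principle -/

section Concentration

variable {α : Type}

/-- The frequency of `O` on the event `A` in the list `l` agrees with `p` up to the relative error
`r` and the absolute error `L / r`. -/
def CloseCount (r L : ℝ) (A O : α → Prop) (p : ℝ) (l : List α) : Prop :=
  |(cnt (fun a => A a ∧ O a) l : ℝ) - p * cnt A l| ≤ r * (p * cnt A l) + L / r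

theorem closeCount_of_exp_le {r L p : ℝ} (hr : 0 < r) (hr1 : r ≤ 1) (hp : 0 ≤ p) {A O : α → Prop}
    {l : List α}
    (h1 : r * cnt (fun a => A a ∧ O a) l - p * (Real.exp r - 1) * cnt A l ≤ L)
    (h2 : -r * cnt (fun a => A a ∧ O a) l - p * (Real.exp (-r) - 1) * cnt A l ≤ L) :
    CloseCount r L A O p l := by
  unfold CloseCount
  set n : ℝ := (cnt (fun a => A a ∧ O a) l : ℝ)
  set N : ℝ := (cnt A l : ℝ) with hN
  have hpN : 0 ≤ p * N := mul_nonneg hp (Nat.cast_nonneg _)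
  have e1 := Real.abs_exp_sub_one_sub_id_le (x := r) (by rwa [abs_of_pos hr])
  have e2 := Real.abs_exp_sub_one_sub_id_le (x := -r) (by rwa [abs_neg, abs_of_pos hr])
  rw [abs_le] at e1 e2
  have k1 : r * (n - p * N) ≤ r * (r * (p * N)) + L := by nlinarith
  have k2 : r * (p * N - n) ≤ r * (r * (p * N)) + L := by nlinarith
  have hL : L = r * (L / r) := by field_simp
  rw [abs_le]
  constructor
  · have : r * (p * N - n) ≤ r * (r * (p * N) + L / r) := by rw [mul_add, ← hL]; exact k2
    have := le_of_mul_le_mul_left this hr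
    linarith
  · have : r * (n - p * N) ≤ r * (r * (p * N) + L / r) := by rw [mul_add, ← hL]; exact k1
    exact le_of_mul_le_mul_left this hr

variable [Fintype α]

/-- An indicator `O`, observed on an event `A` given which it has mean `p`, has an exponential
moment generating function bounded by that of a Poisson variable. -/
theorem sum_mul_exp_le_one {w : α → ℝ} (hw : ∀ a, 0 ≤ w a) (hw1 : ∑ a, w a = 1) {A O : α → Prop}
    {p : ℝ} (hp : ∑ a, w a * ind (A a ∧ O a) = p * ∑ a, w a * ind (A a)) (θ : ℝ) :
    ∑ a, w a * Real.exp (θ * ind (A a ∧ O a) - p * (Real.exp θ - 1) * ind (A a)) ≤ 1 := by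
  set q := p * (Real.exp θ - 1) with hq
  have h1 : ∀ a, Real.exp (θ * ind (A a ∧ O a) - q * ind (A a))
      = 1 + Real.exp (-q) * (Real.exp θ - 1) * ind (A a ∧ O a)
        + (Real.exp (-q) - 1) * ind (A a) := by
    intro a
    by_cases hA : A a
    · by_cases hO : O a
      · rw [ind_pos hA, ind_pos ⟨hA, hO⟩, mul_one, mul_one, sub_eq_add_neg, Real.exp_add]; ring
      · rw [ind_pos hA, ind_neg fun h => hO h.2, mul_zero, mul_one, zero_sub]; ring
    · rw [ind_neg hA, ind_neg fun h => hA h.1]; simp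
  have h2 : ∑ a, w a * Real.exp (θ * ind (A a ∧ O a) - q * ind (A a))
      = ∑ a, w a + Real.exp (-q) * (Real.exp θ - 1) * ∑ a, w a * ind (A a ∧ O a)
        + (Real.exp (-q) - 1) * ∑ a, w a * ind (A a) := by
    rw [Finset.mul_sum, Finset.mul_sum, ← Finset.sum_add_distrib, ← Finset.sum_add_distrib]
    exact Finset.sum_congr rfl fun a _ => by rw [h1]; ring
  rw [h2, hp, hw1]
  have h3 : 0 ≤ ∑ a, w a * ind (A a) :=
    Finset.sum_nonneg fun a _ => mul_nonneg (hw a) (ind_nonneg _)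
  have h4 : (1 + q) * Real.exp (-q) ≤ 1 := by
    rw [Real.exp_neg, ← div_eq_mul_inv, div_le_one (Real.exp_pos _), add_comm]
    exact Real.add_one_le_exp q
  have h5 : 1 + Real.exp (-q) * (Real.exp θ - 1) * (p * ∑ a, w a * ind (A a))
      + (Real.exp (-q) - 1) * ∑ a, w a * ind (A a)
      = 1 + (∑ a, w a * ind (A a)) * ((1 + q) * Real.exp (-q) - 1) := by rw [hq]; ring
  rw [h5]
  nlinarith [mul_nonneg h3 (sub_nonneg.2 h4)]

/-- Markov's inequality and a union bound over finitely many supermartingales, each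
observed at the times `k < K`. -/
theorem chainSum_ind_exists_le {p : List α → α → ℝ} (hp : IsKernel p) {ι : Type} [Fintype ι]
    {G : ι → List α → ℝ} (hG0 : ∀ i h, 0 ≤ G i h) (hG1 : ∀ i, G i [] = 1)
    (hG : ∀ i h, ∑ a, p h a * G i (h ++ [a]) ≤ G i h) (L : ℝ) (K n : ℕ) :
    chainSum p (fun l => ind (∃ i, ∃ k < K, Real.exp L < G i (l.take k))) n []
      ≤ Fintype.card ι * K * Real.exp (-L) := by
  have hsum : ∀ (s : Finset (ι × ℕ)),
      chainSum p (fun l => ∑ j ∈ s, Real.exp (-L) * G j.1 (l.take j.2)) n []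
        ≤ s.card * Real.exp (-L) := by
    classical
    intro s
    induction s using Finset.induction_on with
    | empty => simp [chainSum_const hp]
    | insert j s hj ih =>
      simp only [Finset.sum_insert hj]
      rw [chainSum_add, chainSum_const_mul, Finset.card_insert_of_notMem hj]
      push_cast
      have := chainSum_take_le_of_step hp (hG j.1) j.2 n
      rw [hG1] at this
      nlinarith [Real.exp_pos (-L)]
  have h := hsum (Finset.univ ×ˢ Finset.range K)
  rw [Finset.card_product, Finset.card_univ, Finset.card_range] at h
  push_cast at h
  refine le_trans (chainSum_mono (fun h a => (hp h).1 a) n [] fun l _ => ?_) h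
  have hnn : ∀ j : ι × ℕ, 0 ≤ Real.exp (-L) * G j.1 (l.take j.2) := fun j =>
    mul_nonneg (Real.exp_pos _).le (hG0 _ _)
  by_cases hb : ∃ i, ∃ k < K, Real.exp L < G i (l.take k)
  · rw [ind_pos hb]
    obtain ⟨i, k, hk, hlt⟩ := hb
    refine le_trans ?_ (Finset.single_le_sum (fun j _ => hnn j)
      (Finset.mk_mem_product (Finset.mem_univ i) (Finset.mem_range.2 hk)))
    rw [Real.exp_neg, inv_mul_eq_div, le_div_iff₀ (Real.exp_pos _), one_mul]
    exact hlt.le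
  · rw [ind_neg hb]
    exact Finset.sum_nonneg fun j _ => hnn j

/-- With high probability the counts of finitely many features are accurate at all times. -/
theorem chainSum_ind_not_closeCount_le {p : List α → α → ℝ} (hp : IsKernel p) {ι : Type}
    [Fintype ι] (A O : ι → α → Prop) (ρ : ι → ℝ) (hρ : ∀ i, 0 ≤ ρ i)
    (hAO : ∀ i h, ∑ a, p h a * ind (A i a ∧ O i a) = ρ i * ∑ a, p h a * ind (A i a))
    {r : ℝ} (hr : 0 < r) (hr1 : r ≤ 1) (L : ℝ) (K n : ℕ) :
    chainSum p (fun l => ind (∃ i, ∃ k < K, ¬ CloseCount r L (A i) (O i) (ρ i) (l.take k))) n []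
      ≤ 2 * Fintype.card ι * K * Real.exp (-L) := by
  set θ : Bool → ℝ := fun b => if b then r else -r
  set G : ι × Bool → List α → ℝ := fun i h => Real.exp (θ i.2 * cnt (fun a => A i.1 a ∧ O i.1 a) h
    - ρ i.1 * (Real.exp (θ i.2) - 1) * cnt (A i.1) h) with hG
  have key := chainSum_ind_exists_le hp (G := G) (fun i h => (Real.exp_pos _).le)
    (fun i => by simp [hG, cnt_nil]) (fun i h => by
      have := sum_mul_exp_le_one (hp h).1 (hp h).2 (hAO i.1 h) (θ i.2)
      have h2 : ∑ a, p h a * G i (h ++ [a]) = G i h * ∑ a, p h a *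
          Real.exp (θ i.2 * ind (A i.1 a ∧ O i.1 a)
            - ρ i.1 * (Real.exp (θ i.2) - 1) * ind (A i.1 a)) := by
        rw [Finset.mul_sum]
        refine Finset.sum_congr rfl fun a _ => ?_
        simp only [hG, cnt_append_singleton]
        rw [mul_left_comm, ← Real.exp_add]
        congr 2
        ring
      rw [h2]
      exact mul_le_of_le_one_right (Real.exp_pos _).le this) L K n
  rw [Fintype.card_prod, Fintype.card_bool] at key
  refine le_trans (chainSum_mono (fun h a => (hp h).1 a) n [] fun l _ => ?_)
    (key.trans (le_of_eq (by push_cast; ring)))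
  by_cases hb : ∃ i, ∃ k < K, Real.exp L < G i (l.take k)
  · rw [ind_pos hb]; exact ind_le_one _
  · rw [ind_neg hb, ind_neg]
    rintro ⟨i, k, hk, hcl⟩
    apply hcl
    push Not at hb
    refine closeCount_of_exp_le hr hr1 (hρ i) ?_ ?_
    · exact Real.exp_le_exp.1 (hb (i, true) k hk)
    · exact Real.exp_le_exp.1 (hb (i, false) k hk)

/-- With high probability the sum of the conditional means of `[0, 1]`-valued variables is at most
twice the sum of the variables plus a logarithmic term. -/
theorem chainSum_ind_runSum_le {p : List α → α → ℝ} (hp : IsKernel p) {φ : List α → α → ℝ}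
    (h0 : ∀ h a, 0 ≤ φ h a) (h1 : ∀ h a, φ h a ≤ 1) (L : ℝ) (n : ℕ) :
    chainSum p (fun l => ind (L < runSum (fun h a => (∑ b, p h b * φ h b) / 2 - φ h a) l)) n []
      ≤ Real.exp (-L) := by
  set v : List α → ℝ := fun h => ∑ b, p h b * φ h b with hv
  set G : List α → ℝ := fun l => Real.exp (runSum (fun h a => v h / 2 - φ h a) l) with hG
  have hstep : ∀ h, ∑ a, p h a * G (h ++ [a]) ≤ G h := by
    intro h
    have e1 : ∀ a, Real.exp (-φ h a) ≤ 1 - φ h a / 2 := by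
      intro a
      have hconv := convexOn_exp.2 (Set.mem_univ 0) (Set.mem_univ (-1)) (sub_nonneg.2 (h1 h a))
        (h0 h a) (by ring)
      simp only [smul_eq_mul, mul_zero, zero_add, Real.exp_zero, mul_one, mul_neg] at hconv
      have h3 : Real.exp (-1) ≤ 1 / 2 := by
        have := Real.exp_one_gt_d9
        rw [Real.exp_neg, ← one_div]
        exact one_div_le_one_div_of_le (by norm_num) (by linarith)
      nlinarith [h0 h a]
    have e2 : ∑ a, p h a * Real.exp (-φ h a) ≤ 1 - v h / 2 := by
      have : ∑ a, p h a * (1 - φ h a / 2) = 1 - v h / 2 := by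
        simp only [mul_sub, mul_one, Finset.sum_sub_distrib, (hp h).2, hv, Finset.sum_div,
          mul_div_assoc]
      rw [← this]
      exact Finset.sum_le_sum fun a _ => mul_le_mul_of_nonneg_left (e1 a) ((hp h).1 a)
    have e3 : 1 - v h / 2 ≤ Real.exp (-(v h / 2)) := by
      have := Real.add_one_le_exp (-(v h / 2)); linarith
    have e4 : ∑ a, p h a * G (h ++ [a])
        = G h * Real.exp (v h / 2) * ∑ a, p h a * Real.exp (-φ h a) := by
      rw [Finset.mul_sum]
      refine Finset.sum_congr rfl fun a _ => ?_
      simp only [hG, runSum_append_singleton]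
      rw [mul_left_comm, ← Real.exp_add, ← Real.exp_add]
      congr 2
      ring
    rw [e4]
    calc _ ≤ G h * Real.exp (v h / 2) * Real.exp (-(v h / 2)) :=
          mul_le_mul_of_nonneg_left (e2.trans e3) (by positivity)
      _ = G h := by rw [mul_assoc, ← Real.exp_add, add_neg_cancel, Real.exp_zero, mul_one]
  have key := chainSum_le_of_step (fun h a => (hp h).1 a) hstep n []
  have hG1 : G [] = 1 := by simp [hG, runSum]
  rw [hG1] at key
  calc _ ≤ chainSum p (fun l => Real.exp (-L) * G l) n [] := by
        refine chainSum_mono (fun h a => (hp h).1 a) n [] fun l _ => ?_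
        by_cases hb : L < runSum (fun h a => v h / 2 - φ h a) l
        · rw [ind_pos hb, ← Real.exp_add]
          exact Real.one_le_exp (by linarith)
        · rw [ind_neg hb]; positivity
    _ ≤ Real.exp (-L) := by
        rw [chainSum_const_mul]
        exact mul_le_of_le_one_right (Real.exp_pos _).le key

end Concentration

section Pigeonhole

variable {α : Type}

/-- Pigeonhole principle: bonuses inversely proportional to the number of earlier visits to the
same key sum up to at most a logarithmic term for each key. -/
theorem runSum_bonus_le {κ : Type} [Fintype κ] (f : α → κ) {c : ℝ} (hc : 0 ≤ c) (l : List α) :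
    runSum (fun h a => c / (1 + (cnt (fun b => f b = f a) h : ℝ))) l
      ≤ c * Fintype.card κ * harmonic l.length := by
  classical
  have key : runSum (fun h a => c / (1 + (cnt (fun b => f b = f a) h : ℝ))) l
      = ∑ k : κ, c * (harmonic (cnt (fun b => f b = k) l) : ℝ) := by
    induction l using List.reverseRecOn with
    | nil => simp [runSum, cnt_nil]
    | append_singleton l a ih =>
      rw [runSum_append_singleton, ih, ← Finset.add_sum_erase _ _ (Finset.mem_univ (f a)),
        ← Finset.add_sum_erase (Finset.univ : Finset κ)
          (fun k => c * (harmonic (cnt (fun b => f b = k) (l ++ [a])) : ℝ)) (Finset.mem_univ (f a))]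
      have h1 : cnt (fun b => f b = f a) (l ++ [a]) = cnt (fun b => f b = f a) l + 1 := by
        have := cnt_append_singleton (fun b => f b = f a) l a
        rw [ind_pos rfl] at this
        exact_mod_cast this
      have h2 : ∀ k ∈ Finset.univ.erase (f a),
          cnt (fun b => f b = k) (l ++ [a]) = cnt (fun b => f b = k) l := by
        intro k hk
        have := cnt_append_singleton (fun b => f b = k) l a
        rw [ind_neg (Finset.ne_of_mem_erase hk).symm, add_zero] at this
        exact_mod_cast this
      rw [h1, harmonic_succ, Finset.sum_congr rfl fun k hk => by rw [← h2 k hk]]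
      push_cast
      rw [div_eq_mul_inv, add_comm (1 : ℝ)]
      ring
  rw [key]
  calc _ ≤ ∑ _k : κ, c * (harmonic l.length : ℝ) := by
        refine Finset.sum_le_sum fun k _ => mul_le_mul_of_nonneg_left ?_ hc
        have hm : Monotone harmonic := monotone_nat_of_le_succ fun n => by
          rw [harmonic_succ]
          have : (0 : ℚ) ≤ ((n + 1 : ℕ) : ℚ)⁻¹ := by positivity
          linarith
        exact_mod_cast hm (cnt_le_length _ _)
    _ = _ := by rw [Finset.sum_const, Finset.card_univ, nsmul_eq_mul]; ring

end Pigeonhole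

/-! ### Exploration bonuses and consistent models -/

section Bonus

variable {S A : Type} {𝒵 : Finset ℝ} {M H d : ℕ} [Fintype S] [Fintype A]

/-- Sets of at most `d` times. -/
def smallSets (H d : ℕ) : Finset (Finset (Fin H)) := Finset.univ.filter fun B => B.card ≤ d

/-- Exploration bonus of the state-action pairs of `x` at the times in `B`, after the episodes `h`.
The factor `(S A) ^ (d - |B|)` makes the bonuses of all sets `B` equally expensive. -/
def setBonus (c : ℝ) (d : ℕ) (h : List (Trajectory S A 𝒵 H)) (B : Finset (Fin H))
    (x : Fin H → S × A) : ℝ :=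
  min 1 (c * ((Fintype.card S : ℝ) * Fintype.card A) ^ (d - B.card)
    / (1 + cnt (SAEvent B (B.restrict x)) h))

/-- Sum of the exploration bonuses over all sets of at most `d` times. -/
def totalBonus (c : ℝ) (d : ℕ) (h : List (Trajectory S A 𝒵 H)) (x : Fin H → S × A) : ℝ :=
  ∑ B ∈ smallSets H d, setBonus c d h B x

/-- The model `𝓜` is consistent with the episodes `h`: all joint laws of at most `d` rewards and all
transition probabilities are close to the corresponding frequencies. -/
def IsConsistent (r L : ℝ) (d : ℕ) (h : List (Trajectory S A 𝒵 H)) (𝓜 : RMMDP S A 𝒵 M) : Prop :=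
  (∀ B ∈ smallSets H d, ∀ (k : B → S × A) (z : B → 𝒵),
    CloseCount r L (SAEvent B k) (RewardEvent B z) (moment 𝓜 k z) h) ∧
  ∀ (t : Fin H) (k : prevSet t → S × A) (s : S),
    CloseCount r L (SAEvent (prevSet t) k) (StateEvent t s) (transProb 𝓜 t k s) h

theorem setBonus_nonneg {c : ℝ} (hc : 0 ≤ c) (h : List (Trajectory S A 𝒵 H)) (B : Finset (Fin H))
    (x : Fin H → S × A) : 0 ≤ setBonus c d h B x :=
  le_min zero_le_one (by positivity)

theorem totalBonus_nonneg {c : ℝ} (hc : 0 ≤ c) (h : List (Trajectory S A 𝒵 H))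
    (x : Fin H → S × A) : 0 ≤ totalBonus c d h x :=
  Finset.sum_nonneg fun B _ => setBonus_nonneg hc h B x

theorem totalBonus_le (c : ℝ) (h : List (Trajectory S A 𝒵 H)) (x : Fin H → S × A) :
    totalBonus c d h x ≤ (smallSets H d).card := by
  have := Finset.sum_le_card_nsmul (smallSets H d) (fun B => setBonus c d h B x) 1
    fun B _ => min_le_left _ _
  simpa [totalBonus] using this

theorem setBonus_le_totalBonus {c : ℝ} (hc : 0 ≤ c) (h : List (Trajectory S A 𝒵 H))
    {B : Finset (Fin H)} (hB : B ∈ smallSets H d) (x : Fin H → S × A) :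
    setBonus c d h B x ≤ totalBonus c d h x :=
  Finset.single_le_sum (f := fun B => setBonus c d h B x)
    (fun B _ => setBonus_nonneg hc h B x) hB

/-- Two values close to the same frequency are close to each other. The factor `1 + cnt A l`, in
place of `cnt A l`, covers events that were never observed. -/
theorem one_add_cnt_mul_abs_sub_le {α : Type} {r L p p' : ℝ} {A O : α → Prop} {l : List α}
    (h : CloseCount r L A O p l) (h' : CloseCount r L A O p' l) :
    (1 + cnt A l) * |p - p'| ≤ r * cnt A l * (p + p') + 2 * (L / r) + |p - p'| := by
  have hN : (0 : ℝ) ≤ cnt A l := Nat.cast_nonneg _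
  have h1 : (cnt A l : ℝ) * |p - p'| ≤ r * cnt A l * (p + p') + 2 * (L / r) := by
    rw [← abs_of_nonneg hN, ← abs_mul, abs_of_nonneg hN]
    unfold CloseCount at h h'
    rw [abs_le] at h h' ⊢
    constructor <;> linarith [h.1, h.2, h'.1, h'.2]
  linarith

theorem one_le_card_mul_card [Nonempty S] [Nonempty A] :
    (1 : ℝ) ≤ (Fintype.card S : ℝ) * Fintype.card A := by
  have h1 : 1 ≤ Fintype.card S * Fintype.card A := Nat.mul_pos Fintype.card_pos Fintype.card_pos
  exact_mod_cast h1

theorem abs_moment_sub_le [Nonempty S] [Nonempty A] {r L c : ℝ} (hr : 0 < r) (hL : 0 ≤ L)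
    (hc : 2 * (L / r) + 2 ≤ c) {h : List (Trajectory S A 𝒵 H)} {𝓜 𝓜' : RMMDP S A 𝒵 M}
    (h1 : IsConsistent r L d h 𝓜) (h2 : IsConsistent r L d h 𝓜') {B : Finset (Fin H)}
    (hB : B ∈ smallSets H d) (x : Fin H → S × A) (z : B → 𝒵) :
    |moment 𝓜 (B.restrict x) z - moment 𝓜' (B.restrict x) z| ≤ 2 * r + setBonus c d h B x := by
  have hm := moment_nonneg 𝓜 (B.restrict x) z
  have hm' := moment_nonneg 𝓜' (B.restrict x) z
  have hu := moment_le_one 𝓜 (B.restrict x) z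
  have hu' := moment_le_one 𝓜' (B.restrict x) z
  have key := one_add_cnt_mul_abs_sub_le (h1.1 B hB (B.restrict x) z) (h2.1 B hB (B.restrict x) z)
  set p := moment 𝓜 (B.restrict x) z
  set p' := moment 𝓜' (B.restrict x) z
  have hle1 : |p - p'| ≤ 1 := by rw [abs_le]; constructor <;> linarith
  unfold setBonus
  set N : ℝ := (cnt (SAEvent B (B.restrict x)) h : ℝ) with hNd
  have hN : 0 ≤ N := Nat.cast_nonneg _
  have hc0 : 0 ≤ c := le_trans (by positivity) hc
  have hpow : c ≤ c * ((Fintype.card S : ℝ) * Fintype.card A) ^ (d - B.card) :=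
    le_mul_of_one_le_right hc0 (one_le_pow₀ one_le_card_mul_card)
  rw [← min_add_add_left]
  refine le_min (by linarith) ?_
  have h3 : |p - p'| ≤ 2 * r + c / (1 + N) := by
    rw [← mul_le_mul_iff_of_pos_left (show 0 < 1 + N by linarith), mul_add,
      mul_div_cancel₀ _ (by linarith)]
    have : r * N * (p + p') ≤ r * N * 2 :=
      mul_le_mul_of_nonneg_left (by linarith) (by positivity)
    linarith
  refine h3.trans (add_le_add le_rfl ?_)
  gcongr

theorem card_prevSet (t : Fin H) : (prevSet t).card ≤ 1 := by
  rw [Finset.card_le_one]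
  intro a ha b hb
  have ha := (Finset.mem_filter.1 ha).2
  have hb := (Finset.mem_filter.1 hb).2
  ext
  omega

theorem card_prevSet_lt (hd : 1 ≤ d) (hd2 : 2 ≤ H → 2 ≤ d) (t : Fin H) :
    (prevSet t).card < d := by
  by_cases hH : 2 ≤ H
  · exact (card_prevSet t).trans_lt (hd2 hH)
  · have : prevSet t = ∅ := by
      refine Finset.filter_false_of_mem fun u _ => ?_
      omega
    rw [this, Finset.card_empty]
    omega

theorem sum_abs_transProb_sub_le [Nonempty S] [Nonempty A] {r L c : ℝ} (hr : 0 < r) (hL : 0 ≤ L)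
    (hc : 2 * (L / r) + 2 ≤ c) {h : List (Trajectory S A 𝒵 H)} {𝓜 𝓜' : RMMDP S A 𝒵 M}
    (h1 : IsConsistent r L d h 𝓜) (h2 : IsConsistent r L d h 𝓜') {t : Fin H}
    (ht : (prevSet t).card < d) (x : Fin H → S × A) :
    ∑ s, |transProb 𝓜 t ((prevSet t).restrict x) s - transProb 𝓜' t ((prevSet t).restrict x) s|
      ≤ 2 * r + 2 * setBonus c d h (prevSet t) x := by
  set k := (prevSet t).restrict x with hk
  have hP := transProb_mem 𝓜 t k
  have hP' := transProb_mem 𝓜' t k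
  have key := fun s => one_add_cnt_mul_abs_sub_le (h1.2 t k s) (h2.2 t k s)
  set D := ∑ s, |transProb 𝓜 t k s - transProb 𝓜' t k s|
  unfold setBonus
  rw [← hk]
  set N : ℝ := (cnt (SAEvent (prevSet t) k) h : ℝ)
  have hN : 0 ≤ N := Nat.cast_nonneg _
  have hc0 : 0 ≤ c := le_trans (by positivity) hc
  have hS : (1 : ℝ) ≤ Fintype.card S := by exact_mod_cast Fintype.card_pos (α := S)
  have hA : (1 : ℝ) ≤ Fintype.card A := by exact_mod_cast Fintype.card_pos (α := A)
  have hD2 : D ≤ 2 := by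
    calc D ≤ ∑ s, (transProb 𝓜 t k s + transProb 𝓜' t k s) := by
          refine Finset.sum_le_sum fun s _ => ?_
          rw [abs_le]
          constructor <;> linarith [hP.1 s, hP'.1 s]
      _ = 2 := by rw [Finset.sum_add_distrib, hP.2, hP'.2]; norm_num
  have hD : (1 + N) * D ≤ r * N * 2 + Fintype.card S * (2 * (L / r)) + D := by
    calc (1 + N) * D = ∑ s, (1 + N) * |transProb 𝓜 t k s - transProb 𝓜' t k s| :=
          Finset.mul_sum _ _ _
      _ ≤ ∑ s, (r * N * (transProb 𝓜 t k s + transProb 𝓜' t k s) + 2 * (L / r)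
            + |transProb 𝓜 t k s - transProb 𝓜' t k s|) := Finset.sum_le_sum fun s _ => key s
      _ = _ := by
          rw [Finset.sum_add_distrib, Finset.sum_add_distrib, ← Finset.mul_sum,
            Finset.sum_add_distrib, hP.2, hP'.2]
          simp only [Finset.sum_const, Finset.card_univ, nsmul_eq_mul]
          ring
  have hpow : c * Fintype.card S
      ≤ c * ((Fintype.card S : ℝ) * Fintype.card A) ^ (d - (prevSet t).card) := by
    refine mul_le_mul_of_nonneg_left ?_ hc0
    calc (Fintype.card S : ℝ) ≤ Fintype.card S * Fintype.card A := by nlinarith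
      _ ≤ _ := le_self_pow₀ one_le_card_mul_card (by omega)
  have h3 : D ≤ 2 * r + c * Fintype.card S / (1 + N) := by
    rw [← mul_le_mul_iff_of_pos_left (show 0 < 1 + N by linarith), mul_add,
      mul_div_cancel₀ _ (by linarith)]
    have : (2 * (L / r) + 2) * (Fintype.card S : ℝ) ≤ c * Fintype.card S :=
      mul_le_mul_of_nonneg_right hc (by linarith)
    nlinarith
  have h4 : c * Fintype.card S / (1 + N)
      ≤ c * ((Fintype.card S : ℝ) * Fintype.card A) ^ (d - (prevSet t).card) / (1 + N) := by
    gcongr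
  have h5 : 0 ≤ c * ((Fintype.card S : ℝ) * Fintype.card A) ^ (d - (prevSet t).card) / (1 + N) := by
    positivity
  rcases min_cases 1
    (c * ((Fintype.card S : ℝ) * Fintype.card A) ^ (d - (prevSet t).card) / (1 + N))
    with ⟨h6, _⟩ | ⟨h6, _⟩
  · rw [h6]; linarith
  · rw [h6]; linarith

/-- Two models that are consistent with the same data have transition kernels that are close along
every sequence of state-action pairs with small bonus. -/
theorem prefixSum_stateKernel_sub_le [Nonempty S] [Nonempty A] {r L c : ℝ} (hr : 0 < r)
    (hL : 0 ≤ L) (hc : 2 * (L / r) + 2 ≤ c) (hd : 1 ≤ d) (hd2 : 2 ≤ H → 2 ≤ d)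
    {h : List (Trajectory S A 𝒵 H)} {𝓜 𝓜' : RMMDP S A 𝒵 M}
    (h1 : IsConsistent r L d h 𝓜) (h2 : IsConsistent r L d h 𝓜') (x₀ : S × A)
    (l : List (S × A)) (hl : l.length = H) :
    prefixSum (fun l => ∑ s, |stateKernel 𝓜 l s - stateKernel 𝓜' l s|) l
      ≤ H * (2 * r + 2 * totalBonus c d h (entries x₀ l)) := by
  have hc0 : 0 ≤ c := le_trans (by positivity) hc
  unfold prefixSum
  rw [hl]
  refine (Finset.sum_le_card_nsmul _ _ (2 * r + 2 * totalBonus c d h (entries x₀ l)) ?_).trans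
    (le_of_eq (by rw [Finset.card_range, nsmul_eq_mul]))
  intro t ht
  have ht' : t < H := Finset.mem_range.1 ht
  have hlen : (l.take t).length = ((⟨t, ht'⟩ : Fin H) : ℕ) := by simp [hl]; omega
  simp only [stateKernel_eq_transProb _ x₀ ⟨t, ht'⟩ _ hlen]
  rw [← restrict_prevSet_entries x₀ ⟨t, ht'⟩ (l.take t) (l.drop t) hlen, List.take_append_drop]
  have hlt := card_prevSet_lt hd hd2 (⟨t, ht'⟩ : Fin H)
  refine (sum_abs_transProb_sub_le hr hL hc h1 h2 hlt _).trans ?_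
  have := setBonus_le_totalBonus (d := d) hc0 h (B := prevSet ⟨t, ht'⟩)
    (by simp [smallSets, hlt.le]) (entries x₀ l)
  linarith

/-- Passing to another consistent model increases the expected bonus of a rule `g` by at most a
factor depending on the number of sets `B` and on `H`, up to a small additive error. -/
theorem chainSum_totalBonus_le [Nonempty S] [Nonempty A] {r L c : ℝ} (hr : 0 < r)
    (hL : 0 ≤ L) (hc : 2 * (L / r) + 2 ≤ c) (hd : 1 ≤ d) (hd2 : 2 ≤ H → 2 ≤ d)
    {h : List (Trajectory S A 𝒵 H)} {𝓜 𝓜' : RMMDP S A 𝒵 M}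
    (h1 : IsConsistent r L d h 𝓜) (h2 : IsConsistent r L d h 𝓜') (x₀ : S × A)
    (g : List (S × A) → S → A) :
    chainSum (saKernel (stateKernel 𝓜) g) (fun l => totalBonus c d h (entries x₀ l)) H []
      ≤ chainSum (saKernel (stateKernel 𝓜') g) (fun l => totalBonus c d h (entries x₀ l)) H []
        + (smallSets H d).card * (H * (2 * r + 2 *
          chainSum (saKernel (stateKernel 𝓜') g)
            (fun l => totalBonus c d h (entries x₀ l)) H [])) := by
  have hc0 : 0 ≤ c := le_trans (by positivity) hc
  have hk := isKernel_saKernel (stateKernel_mem 𝓜) g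
  have hk' := isKernel_saKernel (stateKernel_mem 𝓜') g
  have hsim := abs_chainSum_sub_le hk hk' (F := fun l => totalBonus c d h (entries x₀ l))
    (c := (smallSets H d).card) H [] fun l _ => by
      rw [abs_of_nonneg (totalBonus_nonneg hc0 h _)]
      exact totalBonus_le c h _
  have hE : chainSum (saKernel (stateKernel 𝓜') g)
      (prefixSum fun l => ∑ a, |saKernel (stateKernel 𝓜) g l a - saKernel (stateKernel 𝓜') g l a|)
      H [] ≤ chainSum (saKernel (stateKernel 𝓜') g)
        (fun l => H * (2 * r + 2 * totalBonus c d h (entries x₀ l))) H [] := by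
    refine chainSum_mono (fun h a => (hk' h).1 a) H [] fun l hl => ?_
    simp only [sum_abs_saKernel_sub]
    exact prefixSum_stateKernel_sub_le hr hL hc hd hd2 h1 h2 x₀ l (by simpa using hl)
  rw [chainSum_const_mul, chainSum_add, chainSum_const hk', chainSum_const_mul] at hE
  have h0 : prefixSum (fun l => ∑ a, |saKernel (stateKernel 𝓜) g l a
      - saKernel (stateKernel 𝓜') g l a|) [] = 0 := by simp [prefixSum]
  rw [h0, sub_zero] at hsim
  have h3 := (le_abs_self _).trans (hsim.trans (mul_le_mul_of_nonneg_left hE (Nat.cast_nonneg _)))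
  linarith

end Bonus

/-! ### Value differences of consistent models -/

section ValueDifference

variable {S A : Type} {𝒵 : Finset ℝ} {M H d : ℕ}

/-- Sum of the rewards of a list of (state, action, reward) triples. -/
def rewardSum (l : List (S × A × 𝒵)) : ℝ := (l.map fun y => (y.2.2 : ℝ)).sum

theorem rewardSum_ofFn (τ : Trajectory S A 𝒵 H) : rewardSum (List.ofFn τ) = totalReward τ := by
  simp [rewardSum, totalReward, List.map_ofFn, List.sum_ofFn]

theorem abs_rewardSum_le (h𝒵 : ∀ z ∈ 𝒵, |z| ≤ 1) (l : List (S × A × 𝒵)) :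
    |rewardSum l| ≤ l.length := by
  induction l with
  | nil => simp [rewardSum]
  | cons y l ih =>
    have : rewardSum (y :: l) = y.2.2 + rewardSum l := by simp [rewardSum]
    rw [this, List.length_cons, Nat.cast_add, Nat.cast_one]
    have h1 := abs_add_le (y.2.2 : ℝ) (rewardSum l)
    have h2 := h𝒵 _ y.2.2.2
    linarith

/-- A reward kernel that draws the reward at time `t` from `ρ t`, regardless of earlier rewards
(and uniformly beyond the horizon `H`). -/
def timeKernel (ρ : Fin H → S × A → 𝒵 → ℝ) (l : List (S × A × 𝒵)) (x : S × A) : 𝒵 → ℝ :=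
  if h : l.length < H then ρ ⟨l.length, h⟩ x else fun _ => (𝒵.card : ℝ)⁻¹

theorem uniform_mem_stdSimplex (h𝒵 : 𝒵.Nonempty) :
    (fun _ : 𝒵 => (𝒵.card : ℝ)⁻¹) ∈ stdSimplex ℝ 𝒵 := by
  refine ⟨fun _ => by positivity, ?_⟩
  have : (𝒵.card : ℝ) ≠ 0 := by exact_mod_cast h𝒵.card_pos.ne'
  simp [this]

theorem timeKernel_mem (h𝒵 : 𝒵.Nonempty) {ρ : Fin H → S × A → 𝒵 → ℝ}
    (hρ : ∀ t x, ρ t x ∈ stdSimplex ℝ 𝒵) (l : List (S × A × 𝒵)) (x : S × A) :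
    timeKernel ρ l x ∈ stdSimplex ℝ 𝒵 := by
  unfold timeKernel
  split_ifs
  · exact hρ _ _
  · exact uniform_mem_stdSimplex h𝒵

theorem timeKernel_past (ρ : Fin H → S × A → 𝒵 → ℝ) (τ : Trajectory S A 𝒵 H) (t : Fin H) :
    timeKernel ρ (past τ t) = ρ t := by
  have h : (past τ t).length = t := length_past τ t
  funext x
  unfold timeKernel
  rw [dif_pos (by rw [h]; exact t.2)]
  congr 1
  exact Fin.ext h

theorem prod_stepKernel_one_nonneg [Fintype S] {P : List (S × A) → S → ℝ}
    (hP : ∀ l, P l ∈ stdSimplex ℝ S)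
    (π : Policy S A 𝒵) (τ : Trajectory S A 𝒵 H) :
    0 ≤ ∏ t, stepKernel P π (fun _ _ _ => 1) (past τ t) (τ t) := by
  refine Finset.prod_nonneg fun t _ => ?_
  unfold stepKernel
  have := (hP ((past τ t).map sa)).1 (τ t).1
  split_ifs <;> simp [this]

variable [Fintype S] [Fintype A]

theorem nonempty_rewards [Nonempty S] [Nonempty A] (𝓜 : RMMDP S A 𝒵 M) : 𝒵.Nonempty := by
  by_contra hne
  rw [Finset.not_nonempty_iff_eq_empty] at hne
  subst hne
  have h1 : IsEmpty (Fin M) := ⟨fun m => by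
    have := (𝓜.μ_mem m (Classical.arbitrary S) (Classical.arbitrary A)).2
    simp at this⟩
  have := 𝓜.w_mem.2
  simp at this

/-- The mixing weights of two models as one signed family, with the second model negated. -/
def signedWeight (𝓜 𝓜' : RMMDP S A 𝒵 M) : Fin M ⊕ Fin M → ℝ :=
  Sum.elim 𝓜.w fun m => -𝓜'.w m

/-- The reward laws of the atoms of two models. -/
def atomReward (𝓜 𝓜' : RMMDP S A 𝒵 M) : Fin M ⊕ Fin M → S × A → 𝒵 → ℝ :=
  Sum.elim (fun m x => 𝓜.μ m x.1 x.2) fun m x => 𝓜'.μ m x.1 x.2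

theorem atomReward_mem (𝓜 𝓜' : RMMDP S A 𝒵 M) (i : Fin M ⊕ Fin M) (x : S × A) :
    atomReward 𝓜 𝓜' i x ∈ stdSimplex ℝ 𝒵 := by
  rcases i with m | m
  · exact 𝓜.μ_mem _ _ _
  · exact 𝓜'.μ_mem _ _ _

theorem sum_signedWeight_mul_prod (𝓜 𝓜' : RMMDP S A 𝒵 M) (B : Finset (Fin H))
    (x : Fin H → S × A) (z : Fin H → 𝒵) :
    ∑ i, signedWeight 𝓜 𝓜' i * ∏ t ∈ B, atomReward 𝓜 𝓜' i (x t) (z t)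
      = moment 𝓜 (B.restrict x) (B.restrict z) - moment 𝓜' (B.restrict x) (B.restrict z) := by
  rw [Fintype.sum_sum_type]
  unfold moment signedWeight atomReward
  simp only [Sum.elim_inl, Sum.elim_inr, Finset.restrict, neg_mul, Finset.sum_neg_distrib,
    sub_eq_add_neg, Finset.univ_eq_attach]
  congr 1
  · exact Finset.sum_congr rfl fun m _ => by
      rw [Finset.prod_attach B fun t => 𝓜.μ m (x t).1 (x t).2 (z t)]
  · congr 1
    exact Finset.sum_congr rfl fun m _ => by
      rw [Finset.prod_attach B fun t => 𝓜'.μ m (x t).1 (x t).2 (z t)]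

/-- The contribution of one term of the Newton expansion. The factors outside `B` act as reward
laws; the rewards at the times in `B` are imposed, which costs a factor `|𝒵|` for each of them
compared with drawing them uniformly. Hence the expansion is bounded by a planning problem. -/
theorem sum_newton_term_le [Nonempty S] [Nonempty A] (h𝒵 : 𝒵.Nonempty)
    {P : List (S × A) → S → ℝ} (hP : ∀ l, P l ∈ stdSimplex ℝ S) (π : Policy S A 𝒵)
    (x₀ : S × A) {ρ : Fin H → S × A → 𝒵 → ℝ} (hρ : ∀ t x, ρ t x ∈ stdSimplex ℝ 𝒵)
    {B : Finset (Fin H)} (hB : B.card ≤ d) {b : (Fin H → S × A) → ℝ} (hb : ∀ x, 0 ≤ b x) {r : ℝ}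
    (hr : 0 ≤ r) :
    ∑ τ : Trajectory S A 𝒵 H, (∏ t, stepKernel P π (fun _ _ _ => 1) (past τ t) (τ t)) *
        ((∏ t ∈ Finset.univ \ B, ρ t (sa (τ t)) (τ t).2.2) * (r + b fun t => sa (τ t)))
      ≤ (𝒵.card : ℝ) ^ d * (r + optSum P (fun l => b (entries x₀ l)) H []) := by
  classical
  set Z : ℝ := (𝒵.card : ℝ) with hZ
  have hZ1 : 1 ≤ Z := by rw [hZ]; exact_mod_cast h𝒵.card_pos
  set ρ' : Fin H → S × A → 𝒵 → ℝ := fun t x => if t ∈ B then fun _ => Z⁻¹ else ρ t x with hρ'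
  have hρ'm : ∀ t x, ρ' t x ∈ stdSimplex ℝ 𝒵 := by
    intro t x
    simp only [hρ']
    split_ifs
    · exact uniform_mem_stdSimplex h𝒵
    · exact hρ t x
  have hq := timeKernel_mem h𝒵 hρ'm
  have hk := isKernel_stepKernel hP π hq
  have hfac : ∀ τ : Trajectory S A 𝒵 H,
      (∏ t, stepKernel P π (fun _ _ _ => 1) (past τ t) (τ t)) *
        ((∏ t ∈ Finset.univ \ B, ρ t (sa (τ t)) (τ t).2.2) * (r + b fun t => sa (τ t)))
      = Z ^ B.card * ((∏ t, stepKernel P π (timeKernel ρ') (past τ t) (τ t)) *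
        (r + b (entries x₀ ((List.ofFn τ).map sa)))) := by
    intro τ
    have e1 : ∏ t, stepKernel P π (timeKernel ρ') (past τ t) (τ t)
        = (∏ t, stepKernel P π (fun _ _ _ => 1) (past τ t) (τ t))
          * ∏ t, ρ' t (sa (τ t)) (τ t).2.2 := by
      rw [← Finset.prod_mul_distrib]
      refine Finset.prod_congr rfl fun t _ => ?_
      unfold stepKernel
      rw [timeKernel_past, mul_one]
    have e2 : ∏ t, ρ' t (sa (τ t)) (τ t).2.2
        = (∏ t ∈ Finset.univ \ B, ρ t (sa (τ t)) (τ t).2.2) * (Z⁻¹) ^ B.card := by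
      rw [← Finset.prod_sdiff (Finset.subset_univ B)]
      congr 1
      · refine Finset.prod_congr rfl fun t ht => ?_
        simp only [hρ', if_neg (Finset.mem_sdiff.1 ht).2]
      · rw [← Finset.prod_const]
        refine Finset.prod_congr rfl fun t ht => ?_
        simp only [hρ', if_pos ht]
    have e3 : entries x₀ ((List.ofFn τ).map sa) = fun t => sa (τ t) := by
      rw [List.map_ofFn, entries_ofFn]; rfl
    have e4 : Z ^ B.card * (Z⁻¹) ^ B.card = 1 := by
      rw [← mul_pow, mul_inv_cancel₀ (by linarith), one_pow]
    rw [e1, e2, e3]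
    linear_combination (-(∏ t, stepKernel P π (fun _ _ _ => 1) (past τ t) (τ t)) *
        ((∏ t ∈ Finset.univ \ B, ρ t (sa (τ t)) (τ t).2.2) * (r + b fun t => sa (τ t)))) * e4
  simp only [hfac]
  rw [← Finset.mul_sum, sum_prod_past (stepKernel P π (timeKernel ρ'))
    (fun l => r + b (entries x₀ (l.map sa))) H, chainSum_add, chainSum_const hk]
  have h1 := chainSum_stepKernel_le_optSum hP π hq (fun l => b (entries x₀ l)) H []
  have h2 := chainSum_nonneg hk H [] fun l => hb (entries x₀ (l.map sa))
  have h3 : Z ^ B.card ≤ Z ^ d := pow_le_pow_right₀ hZ1 hB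
  exact mul_le_mul h3 (add_le_add le_rfl h1) (by linarith) (by positivity)

/-- Total variation bound for two models with the same transitions: the reward laws of an episode
are mixtures of products, so by the Newton expansion their difference is controlled by the
differences of the joint laws of at most `min (2 * M - 1) H` rewards. -/
theorem sum_abs_rewardProb_sub_le [Nonempty S] [Nonempty A] (hdd : d = min (2 * M - 1) H)
    {P : List (S × A) → S → ℝ} (hP : ∀ l, P l ∈ stdSimplex ℝ S) (π : Policy S A 𝒵)
    (x₀ : S × A) (𝓜 𝓜' : RMMDP S A 𝒵 M) {b : (Fin H → S × A) → ℝ} (hb : ∀ x, 0 ≤ b x) {r : ℝ}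
    (hr : 0 ≤ r) (hclose : ∀ B ∈ smallSets H d, ∀ (x : Fin H → S × A) (z : B → 𝒵),
      |moment 𝓜 (B.restrict x) z - moment 𝓜' (B.restrict x) z| ≤ r + b x) :
    ∑ τ : Trajectory S A 𝒵 H, (∏ t, stepKernel P π (fun _ _ _ => 1) (past τ t) (τ t)) *
        |𝓜.rewardProb τ - 𝓜'.rewardProb τ|
      ≤ (1 + 2 * H : ℝ) ^ (2 * d) *
        ((𝒵.card : ℝ) ^ d * (r + optSum P (fun l => b (entries x₀ l)) H [])) := by
  have h𝒵 := nonempty_rewards 𝓜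
  have hM : 0 < M := by
    by_contra h0
    have h0 : M = 0 := by omega
    subst h0
    have := 𝓜.w_mem.2
    simp at this
  obtain ⟨Fam, hl1, hl2, hsub, hbd⟩ :=
    exists_newton_family (Finset.univ : Finset (Fin H)) (Finset.univ : Finset (Fin M ⊕ Fin M))
  have hcI : (Finset.univ : Finset (Fin M ⊕ Fin M)).card = 2 * M := by
    simp; ring
  have hcU : (Finset.univ : Finset (Fin H)).card = H := by simp
  rw [hcU] at hl1 hl2
  rw [hcI] at hl2
  have hcard : ∀ f ∈ Fam, f.1.card ≤ d := by
    intro f hf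
    have h1 := (hsub f hf).2
    have h2 := Finset.card_le_card (hsub f hf).1
    rw [hcI] at h1
    rw [hcU] at h2
    omega
  have hlen : Fam.length ≤ (1 + 2 * H) ^ (2 * d) := by
    rcases le_total (2 * M - 1) H with h | h
    · rw [min_eq_left h] at hdd
      exact hl2.trans (Nat.pow_le_pow_right (by omega) (by omega))
    · rw [min_eq_right h] at hdd
      rcases Nat.eq_zero_or_pos H with h0 | h0
      · subst h0; simpa using hl1
      · calc Fam.length ≤ 3 ^ H := hl1
          _ ≤ (1 + 2 * H) ^ H := Nat.pow_le_pow_left (by omega) _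
          _ ≤ _ := Nat.pow_le_pow_right (by omega) (by omega)
  set W : Trajectory S A 𝒵 H → ℝ :=
    fun τ => ∏ t, stepKernel P π (fun _ _ _ => 1) (past τ t) (τ t) with hW
  have hW0 : ∀ τ, 0 ≤ W τ := prod_stepKernel_one_nonneg hP π
  set T : ℝ := (𝒵.card : ℝ) ^ d * (r + optSum P (fun l => b (entries x₀ l)) H []) with hT
  have hterm : ∀ f ∈ Fam, ∑ τ : Trajectory S A 𝒵 H, W τ *
      ((∏ t ∈ Finset.univ \ f.1, atomReward 𝓜 𝓜' (f.2 t) (sa (τ t)) (τ t).2.2) *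
        (r + b fun t => sa (τ t))) ≤ T := fun f hf =>
    sum_newton_term_le h𝒵 hP π x₀ (fun t x => atomReward_mem 𝓜 𝓜' (f.2 t) x) (hcard f hf) hb hr
  have hpoint : ∀ τ : Trajectory S A 𝒵 H, |𝓜.rewardProb τ - 𝓜'.rewardProb τ| ≤
      (Fam.map fun f => (∏ t ∈ Finset.univ \ f.1, atomReward 𝓜 𝓜' (f.2 t) (sa (τ t)) (τ t).2.2) *
        (r + b fun t => sa (τ t))).sum := by
    intro τ
    have h1 := hbd (fun i t => atomReward 𝓜 𝓜' i (sa (τ t)) (τ t).2.2) (signedWeight 𝓜 𝓜')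
      fun i t => (atomReward_mem 𝓜 𝓜' i _).1 _
    have h2 : 𝓜.rewardProb τ - 𝓜'.rewardProb τ = ∑ i, signedWeight 𝓜 𝓜' i *
        ∏ t, atomReward 𝓜 𝓜' i (sa (τ t)) (τ t).2.2 := by
      rw [Fintype.sum_sum_type]
      simp [RMMDP.rewardProb, signedWeight, atomReward, sa, sub_eq_add_neg]
    rw [h2]
    refine h1.trans (List.sum_le_sum fun f hf => ?_)
    refine mul_le_mul_of_nonneg_left ?_
      (Finset.prod_nonneg fun t _ => (atomReward_mem 𝓜 𝓜' _ _).1 _)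
    rw [sum_signedWeight_mul_prod 𝓜 𝓜' f.1 (fun t => sa (τ t)) fun t => (τ t).2.2]
    exact hclose f.1 (by simp [smallSets, hcard f hf]) _ _
  have hlist : ∀ L' : List (Finset (Fin H) × (Fin H → Fin M ⊕ Fin M)), (∀ f ∈ L', f ∈ Fam) →
      ∑ τ : Trajectory S A 𝒵 H, W τ * (L'.map fun f =>
        (∏ t ∈ Finset.univ \ f.1, atomReward 𝓜 𝓜' (f.2 t) (sa (τ t)) (τ t).2.2) *
        (r + b fun t => sa (τ t))).sum ≤ L'.length * T := by
    intro L'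
    induction L' with
    | nil => simp
    | cons f L' ih =>
      intro hf
      have h1 := hterm f (hf f (by simp))
      have h2 := ih fun f' hf' => hf f' (by simp [hf'])
      simp only [List.map_cons, List.sum_cons, mul_add (W _), Finset.sum_add_distrib,
        List.length_cons]
      push_cast
      linarith
  have hT0 : 0 ≤ T := by
    -- any planning problem with nonnegative payoff has nonnegative value
    refine le_trans ?_ (sum_newton_term_le (d := d) h𝒵 hP π x₀
      (fun (_ : Fin H) x => atomReward_mem 𝓜 𝓜' (Sum.inl ⟨0, hM⟩) x) (B := ∅) (by simp) hb hr)
    exact Finset.sum_nonneg fun τ _ => mul_nonneg (hW0 τ) (mul_nonneg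
      (Finset.prod_nonneg fun t _ => (atomReward_mem 𝓜 𝓜' _ _).1 _) (add_nonneg hr (hb _)))
  calc _ ≤ ∑ τ : Trajectory S A 𝒵 H, W τ * (Fam.map fun f =>
        (∏ t ∈ Finset.univ \ f.1, atomReward 𝓜 𝓜' (f.2 t) (sa (τ t)) (τ t).2.2) *
        (r + b fun t => sa (τ t))).sum :=
        Finset.sum_le_sum fun τ _ => mul_le_mul_of_nonneg_left (hpoint τ) (hW0 τ)
    _ ≤ Fam.length * T := hlist Fam fun _ h => h
    _ ≤ _ := by
        refine mul_le_mul_of_nonneg_right ?_ hT0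
        exact_mod_cast hlen

theorem trajProb_eq_prod_mul (𝓜 : RMMDP S A 𝒵 M) (π : Policy S A 𝒵) (τ : Trajectory S A 𝒵 H) :
    𝓜.trajProb π τ = (∏ t, stepKernel (stateKernel 𝓜) π (fun _ _ _ => 1) (past τ t) (τ t))
      * 𝓜.rewardProb τ := by
  unfold RMMDP.trajProb stepKernel RMMDP.actionProb
  simp only [Finset.prod_mul_distrib, stateProb_eq, mul_one]

theorem value_eq (𝓜 : RMMDP S A 𝒵 M) (π : Policy S A 𝒵) :
    𝓜.value H π = ∑ m, 𝓜.w m *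
      chainSum (stepKernel (stateKernel 𝓜) π (rewardKernel 𝓜 m)) rewardSum H [] := by
  rw [← sum_trajProb_mul]
  simp only [rewardSum_ofFn]
  rfl

/-- The values of any policy in two models that are consistent with the same data differ by little
if no policy collects a large bonus. -/
theorem abs_value_sub_le [Nonempty S] [Nonempty A] (h𝒵1 : ∀ z ∈ 𝒵, |z| ≤ 1)
    (hdd : d = min (2 * M - 1) H) {r L c : ℝ} (hr : 0 < r)
    (hL : 0 ≤ L) (hc : 2 * (L / r) + 2 ≤ c) (hd : 1 ≤ d) (hd2 : 2 ≤ H → 2 ≤ d)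
    {h : List (Trajectory S A 𝒵 H)} {𝓜 𝓜' : RMMDP S A 𝒵 M}
    (h1 : IsConsistent r L d h 𝓜) (h2 : IsConsistent r L d h 𝓜') (x₀ : S × A)
    {J : ℝ} (hJ : optSum (stateKernel 𝓜) (fun l => totalBonus c d h (entries x₀ l)) H [] ≤ J)
    (π : Policy S A 𝒵) :
    |𝓜.value H π - 𝓜'.value H π| ≤
      H * ((1 + 2 * H : ℝ) ^ (2 * d) * ((𝒵.card : ℝ) ^ d * (2 * r + J)))
        + H * (H * (2 * r + 2 * J)) := by
  have hc0 : 0 ≤ c := le_trans (by positivity) hc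
  have hb : ∀ x, 0 ≤ totalBonus c d h x := fun x => totalBonus_nonneg hc0 h x
  set W : Trajectory S A 𝒵 H → ℝ := fun τ =>
    ∏ t, stepKernel (stateKernel 𝓜) π (fun _ _ _ => 1) (past τ t) (τ t) with hW
  have hW0 : ∀ τ, 0 ≤ W τ := prod_stepKernel_one_nonneg (stateKernel_mem 𝓜) π
  -- the intermediate model has the transitions of `𝓜` and the rewards of `𝓜'`
  set V : ℝ := ∑ m, 𝓜'.w m *
      chainSum (stepKernel (stateKernel 𝓜) π (rewardKernel 𝓜' m)) rewardSum H [] with hV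
  have hV' : V = ∑ τ : Trajectory S A 𝒵 H, W τ * 𝓜'.rewardProb τ * totalReward τ := by
    rw [hV]
    simp only [← sum_prod_past, Finset.mul_sum, rewardSum_ofFn]
    rw [Finset.sum_comm]
    refine Finset.sum_congr rfl fun τ _ => ?_
    rw [RMMDP.rewardProb, Finset.mul_sum, Finset.sum_mul]
    refine Finset.sum_congr rfl fun m _ => ?_
    have : ∏ t, stepKernel (stateKernel 𝓜) π (rewardKernel 𝓜' m) (past τ t) (τ t)
        = W τ * ∏ t, 𝓜'.μ m (τ t).1 (τ t).2.1 (τ t).2.2 := by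
      rw [hW, ← Finset.prod_mul_distrib]
      refine Finset.prod_congr rfl fun t _ => ?_
      simp [stepKernel, rewardKernel, sa]
    rw [this]
    ring
  have hfirst : |𝓜.value H π - V| ≤
      H * ((1 + 2 * H : ℝ) ^ (2 * d) * ((𝒵.card : ℝ) ^ d * (2 * r + J))) := by
    have e1 : 𝓜.value H π - V = ∑ τ : Trajectory S A 𝒵 H,
        W τ * (𝓜.rewardProb τ - 𝓜'.rewardProb τ) * totalReward τ := by
      rw [hV', RMMDP.value, ← Finset.sum_sub_distrib]
      refine Finset.sum_congr rfl fun τ _ => ?_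
      rw [trajProb_eq_prod_mul]
      ring
    rw [e1]
    calc _ ≤ ∑ τ : Trajectory S A 𝒵 H,
          |W τ * (𝓜.rewardProb τ - 𝓜'.rewardProb τ) * totalReward τ| :=
          Finset.abs_sum_le_sum_abs _ _
      _ ≤ ∑ τ : Trajectory S A 𝒵 H, H * (W τ * |𝓜.rewardProb τ - 𝓜'.rewardProb τ|) := by
          refine Finset.sum_le_sum fun τ _ => ?_
          rw [abs_mul, abs_mul, abs_of_nonneg (hW0 τ), mul_comm]
          refine mul_le_mul_of_nonneg_right ?_ (mul_nonneg (hW0 τ) (abs_nonneg _))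
          rw [← rewardSum_ofFn]
          simpa using abs_rewardSum_le h𝒵1 (List.ofFn τ)
      _ ≤ _ := by
          rw [← Finset.mul_sum]
          refine mul_le_mul_of_nonneg_left ?_ (Nat.cast_nonneg _)
          refine (sum_abs_rewardProb_sub_le (d := d) hdd (stateKernel_mem 𝓜) π x₀ 𝓜 𝓜' hb
            (r := 2 * r) (by positivity) fun B hB x z => ?_).trans ?_
          · exact (abs_moment_sub_le hr hL hc h1 h2 hB x z).trans
              (add_le_add le_rfl (setBonus_le_totalBonus hc0 h hB x))
          · gcongr
  have hsecond : |V - 𝓜'.value H π| ≤ H * (H * (2 * r + 2 * J)) := by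
    rw [hV, value_eq, ← Finset.sum_sub_distrib]
    calc _ ≤ ∑ m, |𝓜'.w m * chainSum (stepKernel (stateKernel 𝓜) π (rewardKernel 𝓜' m))
            rewardSum H [] - 𝓜'.w m *
            chainSum (stepKernel (stateKernel 𝓜') π (rewardKernel 𝓜' m)) rewardSum H []| :=
          Finset.abs_sum_le_sum_abs _ _
      _ ≤ ∑ m, 𝓜'.w m * (H * (H * (2 * r + 2 * J))) := by
          refine Finset.sum_le_sum fun m _ => ?_
          rw [← mul_sub, abs_mul, abs_of_nonneg (𝓜'.w_mem.1 m)]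
          refine mul_le_mul_of_nonneg_left ?_ (𝓜'.w_mem.1 m)
          have hq := rewardKernel_mem 𝓜' m
          have hk := isKernel_stepKernel (stateKernel_mem 𝓜) π hq
          have hk' := isKernel_stepKernel (stateKernel_mem 𝓜') π hq
          have hsim := abs_chainSum_sub_le hk' hk (F := rewardSum) (c := H) H [] fun l hl => by
            refine (abs_rewardSum_le h𝒵1 l).trans (le_of_eq ?_)
            rw [hl]; simp
          rw [abs_sub_comm]
          refine hsim.trans (mul_le_mul_of_nonneg_left ?_ (Nat.cast_nonneg _))
          have h0 : prefixSum (fun l => ∑ a,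
              |stepKernel (stateKernel 𝓜') π (rewardKernel 𝓜' m) l a
                - stepKernel (stateKernel 𝓜) π (rewardKernel 𝓜' m) l a|) [] = 0 := by
            simp [prefixSum]
          rw [h0, sub_zero]
          have hE : chainSum (stepKernel (stateKernel 𝓜) π (rewardKernel 𝓜' m))
              (prefixSum fun l => ∑ a, |stepKernel (stateKernel 𝓜') π (rewardKernel 𝓜' m) l a
                - stepKernel (stateKernel 𝓜) π (rewardKernel 𝓜' m) l a|) H []
              ≤ chainSum (stepKernel (stateKernel 𝓜) π (rewardKernel 𝓜' m))
                (fun l => H * (2 * r + 2 * totalBonus c d h (entries x₀ (l.map sa)))) H [] := by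
            refine chainSum_mono (fun h a => (hk h).1 a) H [] fun l hl => ?_
            refine le_trans (le_of_eq ?_) (prefixSum_stateKernel_sub_le hr hL hc hd hd2 h2 h1 x₀
              (l.map sa) (by simpa using hl))
            simp only [sum_abs_stepKernel_sub _ _ π hq, prefixSum, List.length_map, List.map_take]
          refine hE.trans ?_
          rw [chainSum_const_mul, chainSum_add, chainSum_const hk, chainSum_const_mul]
          have := chainSum_stepKernel_le_optSum (stateKernel_mem 𝓜) π hq
            (fun l => totalBonus c d h (entries x₀ l)) H []
          refine mul_le_mul_of_nonneg_left ?_ (Nat.cast_nonneg _)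
          simp only [List.map_nil] at this
          linarith
      _ = _ := by rw [← Finset.sum_mul, 𝓜'.w_mem.2, one_mul]
  calc _ = |(𝓜.value H π - V) + (V - 𝓜'.value H π)| := by congr 1; ring
    _ ≤ _ := (abs_add_le _ _).trans (add_le_add hfirst hsecond)

end ValueDifference

/-! ### The learning algorithm -/

section RunSum

variable {α : Type}

theorem runSum_mono {φ ψ : List α → α → ℝ} {l : List α}
    (h : ∀ k < l.length, ∀ a, φ (l.take k) a ≤ ψ (l.take k) a) : runSum φ l ≤ runSum ψ l := by
  refine Finset.sum_le_sum fun k hk => ?_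
  rw [List.getElem?_eq_getElem (Finset.mem_range.1 hk)]
  exact h k (Finset.mem_range.1 hk) _

theorem runSum_const (c : ℝ) (l : List α) : runSum (fun _ _ => c) l = l.length * c := by
  have h : ∀ k ∈ Finset.range l.length, (l[k]?).elim 0 (fun _ => c) = c := fun k hk => by
    rw [List.getElem?_eq_getElem (Finset.mem_range.1 hk), Option.elim_some]
  rw [runSum, Finset.sum_congr rfl h, Finset.sum_const, Finset.card_range, nsmul_eq_mul]

theorem runSum_sub (φ ψ : List α → α → ℝ) (l : List α) :
    runSum (fun h a => φ h a - ψ h a) l = runSum φ l - runSum ψ l := by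
  rw [runSum, runSum, runSum, ← Finset.sum_sub_distrib]
  refine Finset.sum_congr rfl fun k _ => ?_
  cases l[k]? <;> simp

theorem runSum_div (φ : List α → α → ℝ) (c : ℝ) (l : List α) :
    runSum (fun h a => φ h a / c) l = runSum φ l / c := by
  rw [runSum, runSum, Finset.sum_div]
  refine Finset.sum_congr rfl fun k _ => ?_
  cases l[k]? <;> simp

theorem runSum_sum {ι : Type} (s : Finset ι) (φ : ι → List α → α → ℝ) (l : List α) :
    runSum (fun h a => ∑ i ∈ s, φ i h a) l = ∑ i ∈ s, runSum (φ i) l := by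
  simp only [runSum]
  rw [Finset.sum_comm]
  refine Finset.sum_congr rfl fun k _ => ?_
  cases l[k]? <;> simp

end RunSum

section Learning

variable {S A : Type} {𝒵 : Finset ℝ} {M H d K : ℕ} [Fintype S] [Fintype A]

/-- The bonuses met along any sequence of episodes have a total that grows logarithmically. -/
theorem runSum_totalBonus_le {c : ℝ} (hc : 0 ≤ c) (l : List (Trajectory S A 𝒵 H)) :
    runSum (fun h τ => totalBonus c d h fun t => sa (τ t)) l
      ≤ (smallSets H d).card *
        (c * ((Fintype.card S : ℝ) * Fintype.card A) ^ d * harmonic l.length) := by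
  unfold totalBonus
  rw [runSum_sum, ← nsmul_eq_mul]
  refine Finset.sum_le_card_nsmul _ _ _ fun B hB => ?_
  have hB : B.card ≤ d := by simpa [smallSets] using hB
  set N : ℝ := (Fintype.card S : ℝ) * Fintype.card A with hN
  have h1 := runSum_bonus_le (fun τ : Trajectory S A 𝒵 H => B.restrict fun t => sa (τ t))
    (c := c * N ^ (d - B.card)) (by positivity) l
  refine (runSum_mono fun k _ τ => min_le_right _ _).trans (h1.trans (le_of_eq ?_))
  have h2 : (Fintype.card (B → S × A) : ℝ) = N ^ B.card := by
    rw [Fintype.card_fun, Fintype.card_coe, Fintype.card_prod]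
    push_cast
    rfl
  rw [h2, mul_assoc c, ← pow_add, Nat.sub_add_cancel hB]

theorem sum_dataProb_mul (L : Learner S A 𝒵 H K) (𝓜 : RMMDP S A 𝒵 M)
    (F : List (Trajectory S A 𝒵 H) → ℝ) :
    ∑ D, L.dataProb 𝓜 D * F (List.ofFn D)
      = chainSum (fun h τ => 𝓜.trajProb (L.explore h) τ) F K [] :=
  sum_prod_past (fun h τ => 𝓜.trajProb (L.explore h) τ) F K

theorem isKernel_trajProb (𝓜 : RMMDP S A 𝒵 M) (E : List (Trajectory S A 𝒵 H) → Policy S A 𝒵) :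
    IsKernel fun h τ => 𝓜.trajProb (E h) τ :=
  fun _ => ⟨fun τ => trajProb_nonneg 𝓜 _ τ, sum_trajProb 𝓜 _⟩

/-- A lower bound for the success probability from three bad events. -/
theorem le_successProb (L : Learner S A 𝒵 H K) (𝓜 : RMMDP S A 𝒵 M) {ε η : ℝ}
    {b₁ b₂ b₃ : List (Trajectory S A 𝒵 H) → Prop}
    (hgood : ∀ D : Fin K → Trajectory S A 𝒵 H, ¬ b₁ (List.ofFn D) → ¬ b₂ (List.ofFn D) →
      ¬ b₃ (List.ofFn D) → 𝓜.IsEpsOptimal H ε (L.output D))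
    (hη : chainSum (fun h τ => 𝓜.trajProb (L.explore h) τ) (fun l => ind (b₁ l)) K []
      + chainSum (fun h τ => 𝓜.trajProb (L.explore h) τ) (fun l => ind (b₂ l)) K []
      + chainSum (fun h τ => 𝓜.trajProb (L.explore h) τ) (fun l => ind (b₃ l)) K [] ≤ η) :
    1 - η ≤ L.successProb 𝓜 ε := by
  have hk := isKernel_trajProb 𝓜 L.explore
  have h0 : ∀ D, 0 ≤ L.dataProb 𝓜 D := fun D =>
    Finset.prod_nonneg fun k _ => trajProb_nonneg 𝓜 _ _
  have h1 : ∑ D, L.dataProb 𝓜 D = 1 := by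
    have := sum_dataProb_mul L 𝓜 fun _ => 1
    simpa [chainSum_const hk] using this
  rw [← chainSum_add, ← chainSum_add, ← sum_dataProb_mul] at hη
  have h2 : 1 - ∑ D, L.dataProb 𝓜 D * (ind (b₁ (List.ofFn D)) + ind (b₂ (List.ofFn D))
      + ind (b₃ (List.ofFn D))) ≤ L.successProb 𝓜 ε := by
    rw [← h1, ← Finset.sum_sub_distrib]
    unfold Learner.successProb
    refine Finset.sum_le_sum fun D _ => ?_
    have hn1 := ind_nonneg (b₁ (List.ofFn D))
    have hn2 := ind_nonneg (b₂ (List.ofFn D))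
    have hn3 := ind_nonneg (b₃ (List.ofFn D))
    split_ifs with hopt
    · nlinarith [h0 D, mul_nonneg (h0 D) (add_nonneg (add_nonneg hn1 hn2) hn3)]
    · have h3 : 1 ≤ ind (b₁ (List.ofFn D)) + ind (b₂ (List.ofFn D)) + ind (b₃ (List.ofFn D)) := by
        by_cases c1 : b₁ (List.ofFn D)
        · rw [ind_pos c1]; linarith
        by_cases c2 : b₂ (List.ofFn D)
        · rw [ind_pos c2]; linarith
        by_cases c3 : b₃ (List.ofFn D)
        · rw [ind_pos c3]; linarith
        exact absurd (hgood D c1 c2 c3) hopt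
      nlinarith [h0 D]
  linarith

/-- Optimality transfers between models whose values are uniformly close. -/
theorem isEpsOptimal_of_abs_value_sub_le [Nonempty A] {𝓜 𝓜' : RMMDP S A 𝒵 M} {ε δ δ' : ℝ}
    (hclose : ∀ π, |𝓜.value H π - 𝓜'.value H π| ≤ δ) {π : Policy S A 𝒵}
    (hπ : 𝓜'.optimalValue H - δ' ≤ 𝓜'.value H π) (hε : 2 * δ + δ' ≤ ε) :
    𝓜.IsEpsOptimal H ε π := by
  have h1 : 𝓜.optimalValue H ≤ 𝓜'.optimalValue H + δ := by
    obtain ⟨a⟩ : Nonempty A := inferInstance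
    have : Nonempty (Policy S A 𝒵) := ⟨fun _ _ => a⟩
    refine ciSup_le fun π' => ?_
    have h2 := le_ciSup (𝓜'.bddAbove_range_value H) π'
    have h3 := (abs_le.1 (hclose π')).2
    unfold RMMDP.optimalValue
    linarith
  have h2 := (abs_le.1 (hclose π)).1
  unfold RMMDP.IsEpsOptimal
  linarith

theorem exists_nearly_optimal [Nonempty A] (𝓜 : RMMDP S A 𝒵 M) (H : ℕ) {δ : ℝ} (hδ : 0 < δ) :
    ∃ π : Policy S A 𝒵, 𝓜.optimalValue H - δ ≤ 𝓜.value H π := by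
  obtain ⟨a⟩ : Nonempty A := inferInstance
  have : Nonempty (Policy S A 𝒵) := ⟨fun _ _ => a⟩
  obtain ⟨π, hπ⟩ := exists_lt_of_lt_ciSup
    (show 𝓜.optimalValue H - δ < ⨆ π : Policy S A 𝒵, 𝓜.value H π by
      unfold RMMDP.optimalValue; linarith)
  exact ⟨π, hπ.le⟩

theorem card_sigma_reward_le [Nonempty S] [Nonempty A] (h𝒵 : 𝒵.Nonempty) :
    (Fintype.card ((B : {B // B ∈ smallSets H d}) × ((B.1 → S × A) × (B.1 → 𝒵))) : ℝ)
      ≤ (smallSets H d).card *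
        (((Fintype.card S : ℝ) * Fintype.card A) ^ d * (𝒵.card : ℝ) ^ d) := by
  have hZ : (1 : ℝ) ≤ 𝒵.card := by exact_mod_cast h𝒵.card_pos
  rw [Fintype.card_sigma]
  push_cast
  refine (Finset.sum_le_card_nsmul _ _
    (((Fintype.card S : ℝ) * Fintype.card A) ^ d * (𝒵.card : ℝ) ^ d) fun B _ => ?_).trans
    (le_of_eq (by rw [Finset.card_univ, Fintype.card_coe, nsmul_eq_mul]))
  have hB : B.1.card ≤ d := by simpa [smallSets] using B.2
  rw [Fintype.card_prod, Fintype.card_fun, Fintype.card_fun, Fintype.card_coe, Fintype.card_coe,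
    Fintype.card_prod]
  push_cast
  exact mul_le_mul (pow_le_pow_right₀ one_le_card_mul_card hB) (pow_le_pow_right₀ hZ hB)
    (by positivity) (by positivity)

theorem card_sigma_state_le [Nonempty S] [Nonempty A] (hd : 1 ≤ d) (hd2 : 2 ≤ H → 2 ≤ d) :
    (Fintype.card ((t : Fin H) × ((prevSet t → S × A) × S)) : ℝ)
      ≤ H * ((Fintype.card S : ℝ) * Fintype.card A) ^ d := by
  have hS : (1 : ℝ) ≤ Fintype.card S := by exact_mod_cast Fintype.card_pos (α := S)
  have hA : (1 : ℝ) ≤ Fintype.card A := by exact_mod_cast Fintype.card_pos (α := A)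
  rw [Fintype.card_sigma]
  push_cast
  refine (Finset.sum_le_card_nsmul _ _
    (((Fintype.card S : ℝ) * Fintype.card A) ^ d) fun t _ => ?_).trans
    (le_of_eq (by rw [Finset.card_univ, Fintype.card_fin, nsmul_eq_mul]))
  have ht := card_prevSet_lt hd hd2 t
  rw [Fintype.card_prod, Fintype.card_fun, Fintype.card_coe, Fintype.card_prod]
  push_cast
  calc _ ≤ ((Fintype.card S : ℝ) * Fintype.card A) ^ (prevSet t).card
        * ((Fintype.card S : ℝ) * Fintype.card A) := by
        refine mul_le_mul_of_nonneg_left (by nlinarith) (by positivity)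
    _ = ((Fintype.card S : ℝ) * Fintype.card A) ^ ((prevSet t).card + 1) := (pow_succ _ _).symm
    _ ≤ _ := pow_le_pow_right₀ one_le_card_mul_card ht

/-- If the optimal bonus is small in one consistent model, it is small in every other one. -/
theorem optSum_le_of_optSum_le [Nonempty S] [Nonempty A] {r L c F : ℝ} (hr : 0 < r)
    (hL : 0 ≤ L) (hc : 2 * (L / r) + 2 ≤ c) (hd : 1 ≤ d) (hd2 : 2 ≤ H → 2 ≤ d)
    (hF1 : 1 ≤ F) (hH : (1 : ℝ) ≤ H) (hF : ((smallSets H d).card : ℝ) ≤ F)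
    {h : List (Trajectory S A 𝒵 H)} {𝓜 𝓜' : RMMDP S A 𝒵 M}
    (h1 : IsConsistent r L d h 𝓜) (h2 : IsConsistent r L d h 𝓜') (x₀ : S × A)
    (hJ : optSum (stateKernel 𝓜') (fun l => totalBonus c d h (entries x₀ l)) H []
      ≤ 6 * F * H * r) :
    optSum (stateKernel 𝓜) (fun l => totalBonus c d h (entries x₀ l)) H []
      ≤ 3 * F * H * (7 * F * H * r) := by
  have hc0 : 0 ≤ c := le_trans (by positivity) hc
  obtain ⟨g, hg⟩ := exists_chainSum_eq_optSum (stateKernel 𝓜)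
    (fun l => totalBonus c d h (entries x₀ l)) H
  rw [← hg]
  have h3 := chainSum_totalBonus_le hr hL hc hd hd2 h1 h2 x₀ g
  have h4 := (chainSum_saKernel_le_optSum (stateKernel_mem 𝓜') g
    (fun l => totalBonus c d h (entries x₀ l)) H []).trans hJ
  have hv0 := chainSum_nonneg (isKernel_saKernel (stateKernel_mem 𝓜') g) H []
    fun l => totalBonus_nonneg (d := d) hc0 h (entries x₀ l)
  refine h3.trans ?_
  set v := chainSum (saKernel (stateKernel 𝓜') g) (fun l => totalBonus c d h (entries x₀ l)) H []
  have h5 : ((smallSets H d).card : ℝ) * (H * (2 * r + 2 * v))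
      ≤ F * (H * (2 * r + 2 * (6 * F * H * r))) := by gcongr
  have h6 : 1 ≤ F * H := one_le_mul_of_one_le_of_one_le hF1 hH
  have h7 : F * (H * r) ≤ (F * H) * (F * (H * r)) := le_mul_of_one_le_left (by positivity) h6
  linarith

/-- If the optimal bonus is large in one consistent model and attained there by `g`, then `g`
collects a significant bonus in every other consistent model. -/
theorem le_chainSum_of_lt_chainSum [Nonempty S] [Nonempty A] {r L c F : ℝ} (hr : 0 < r)
    (hL : 0 ≤ L) (hc : 2 * (L / r) + 2 ≤ c) (hd : 1 ≤ d) (hd2 : 2 ≤ H → 2 ≤ d)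
    (hF1 : 1 ≤ F) (hH : (1 : ℝ) ≤ H) (hF : ((smallSets H d).card : ℝ) ≤ F)
    {h : List (Trajectory S A 𝒵 H)} {𝓜 𝓜' : RMMDP S A 𝒵 M}
    (h1 : IsConsistent r L d h 𝓜) (h2 : IsConsistent r L d h 𝓜') (x₀ : S × A)
    (g : List (S × A) → S → A)
    (hJ : 6 * F * H * r < chainSum (saKernel (stateKernel 𝓜') g)
      (fun l => totalBonus c d h (entries x₀ l)) H []) :
    r ≤ chainSum (saKernel (stateKernel 𝓜) g)
      (fun l => totalBonus c d h (entries x₀ l)) H [] := by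
  have hc0 : 0 ≤ c := le_trans (by positivity) hc
  have h3 := chainSum_totalBonus_le hr hL hc hd hd2 h2 h1 x₀ g
  have hv0 := chainSum_nonneg (isKernel_saKernel (stateKernel_mem 𝓜) g) H []
    fun l => totalBonus_nonneg (d := d) hc0 h (entries x₀ l)
  by_contra hlt
  push Not at hlt
  set v := chainSum (saKernel (stateKernel 𝓜) g) (fun l => totalBonus c d h (entries x₀ l)) H []
  have h5 : ((smallSets H d).card : ℝ) * (H * (2 * r + 2 * v)) ≤ F * (H * (2 * r + 2 * r)) := by
    gcongr
  have h6 : 1 ≤ F * H := one_le_mul_of_one_le_of_one_le hF1 hH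
  have h7 : r ≤ (F * H) * r := le_mul_of_one_le_left hr.le h6
  linarith

/-- Some exploration rule has an expected bonus below `r`: the total bonus met in the `K` episodes
grows only logarithmically, and by `hrun` it is at least half the sum of its conditional means, up
to the term `F * L`. -/
theorem exists_chainSum_lt [Nonempty S] [Nonempty A] {r L c F : ℝ}
    (hc : 0 ≤ c) (hF1 : 1 ≤ F) (hF : ((smallSets H d).card : ℝ) ≤ F) (x₀ : S × A)
    (𝓜 : RMMDP S A 𝒵 M) (g : List (Trajectory S A 𝒵 H) → List (S × A) → S → A)
    (l : List (Trajectory S A 𝒵 H)) (hl : l.length = K)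
    (hrun : runSum (fun h τ => (∑ τ' : Trajectory S A 𝒵 H, 𝓜.trajProb (ignoreRewards (g h)) τ' *
        ((totalBonus c d h fun t => sa (τ' t)) / F)) / 2
        - (totalBonus c d h fun t => sa (τ t)) / F) l ≤ L)
    (hK : 2 * (F * (c * ((Fintype.card S : ℝ) * Fintype.card A) ^ d * harmonic K) + F * L)
      < K * r) :
    ∃ k < K, chainSum (saKernel (stateKernel 𝓜) (g (l.take k)))
      (fun l' => totalBonus c d (l.take k) (entries x₀ l')) H [] < r := by
  by_contra hv
  push Not at hv
  have hF0 : 0 < F := by linarith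
  have hmean : ∀ h, ∑ τ' : Trajectory S A 𝒵 H, 𝓜.trajProb (ignoreRewards (g h)) τ' *
      ((totalBonus c d h fun t => sa (τ' t)) / F)
      = chainSum (saKernel (stateKernel 𝓜) (g h))
        (fun l' => totalBonus c d h (entries x₀ l')) H [] / F := by
    intro h
    rw [← sum_trajProb_ignoreRewards_mul, Finset.sum_div]
    refine Finset.sum_congr rfl fun τ _ => ?_
    simp only [entries_ofFn]
    ring
  simp only [hmean] at hrun
  rw [runSum_sub, runSum_div _ F] at hrun
  have hlow : (K : ℝ) * (r / F / 2) ≤ runSum (fun h (_ : Trajectory S A 𝒵 H) =>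
      chainSum (saKernel (stateKernel 𝓜) (g h))
        (fun l' => totalBonus c d h (entries x₀ l')) H [] / F / 2) l := by
    rw [← hl, ← runSum_const]
    refine runSum_mono fun k hk' _ => ?_
    have := hv k (hl ▸ hk')
    gcongr
  have hup := runSum_totalBonus_le (d := d) hc l
  rw [hl] at hup
  have hharm : (0 : ℝ) ≤ (harmonic K : ℝ) := by
    have : (0 : ℚ) ≤ harmonic K := Finset.sum_nonneg fun i _ => by positivity
    exact_mod_cast this
  have hup' := hup.trans (mul_le_mul_of_nonneg_right hF (by positivity))
  set R := runSum (fun h τ => totalBonus c d h fun t => sa (τ t)) l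
  have h8 : (K : ℝ) * (r / F / 2) - R / F ≤ L := by linarith
  have h9 := mul_le_mul_of_nonneg_left h8 (show 0 ≤ 2 * F by linarith)
  have e : 2 * F * ((K : ℝ) * (r / F / 2) - R / F) = K * r - 2 * R := by
    field_simp
  linarith

/-- The learning algorithm: it explores with a policy that ignores rewards and maximises the bonus
in a model consistent with the data, and finally plays nearly optimally in the consistent model
of an episode before which the maximal bonus was small. -/
theorem exists_learner [Nonempty S] [Nonempty A] (h𝒵1 : ∀ z ∈ 𝒵, |z| ≤ 1)
    (hdd : d = min (2 * M - 1) H) (hd : 1 ≤ d) (hd2 : 2 ≤ H → 2 ≤ d) {r L c ε η F : ℝ}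
    (hr : 0 < r) (hr1 : r ≤ 1) (hL : 0 ≤ L) (hc : 2 * (L / r) + 2 ≤ c) (hε : 0 < ε)
    (hF : ((smallSets H d).card : ℝ) ≤ F)
    (hη : 2 * (F * (((Fintype.card S : ℝ) * Fintype.card A) ^ d * (𝒵.card : ℝ) ^ d)) * K
        * Real.exp (-L)
      + 2 * (H * ((Fintype.card S : ℝ) * Fintype.card A) ^ d) * K * Real.exp (-L)
      + Real.exp (-L) ≤ η)
    (hK : 2 * (F * (c * ((Fintype.card S : ℝ) * Fintype.card A) ^ d * harmonic K) + F * L) < K * r)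
    (hfinal : ∀ J : ℝ, J ≤ 3 * F * H * (7 * F * H * r) →
      H * ((1 + 2 * H : ℝ) ^ (2 * d) * ((𝒵.card : ℝ) ^ d * (2 * r + J)))
        + H * (H * (2 * r + 2 * J)) ≤ ε / 3) :
    ∃ Alg : Learner S A 𝒵 H K, ∀ 𝓜 : RMMDP S A 𝒵 M, 1 - η ≤ Alg.successProb 𝓜 ε := by
  classical
  rcases isEmpty_or_nonempty (RMMDP S A 𝒵 M) with hemp | ⟨⟨𝓜₀⟩⟩
  -- without models, for instance if `𝒵` is empty, any algorithm will do
  · obtain ⟨a⟩ : Nonempty A := inferInstance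
    exact ⟨⟨fun _ _ _ => a, fun _ _ _ => a⟩, fun 𝓜 => (hemp.false 𝓜).elim⟩
  have h𝒵 := nonempty_rewards 𝓜₀
  obtain ⟨x₀⟩ : Nonempty (S × A) := inferInstance
  have hc0 : 0 ≤ c := le_trans (by positivity) hc
  have hH1 : 1 ≤ H := by omega
  have hH : (1 : ℝ) ≤ H := by exact_mod_cast hH1
  have hF1 : 1 ≤ F := by
    refine le_trans ?_ hF
    have : (∅ : Finset (Fin H)) ∈ smallSets H d := by simp [smallSets]
    exact_mod_cast Finset.card_pos.2 ⟨_, this⟩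
  set bon : List (Trajectory S A 𝒵 H) → List (S × A) → ℝ :=
    fun h l => totalBonus c d h (entries x₀ l) with hbon
  -- the model used for planning after the episodes `h` is consistent with `h` if possible
  have hmodel : ∀ h : List (Trajectory S A 𝒵 H), ∃ 𝓜' : RMMDP S A 𝒵 M,
      (∃ 𝓜 : RMMDP S A 𝒵 M, IsConsistent r L d h 𝓜) → IsConsistent r L d h 𝓜' := by
    intro h
    by_cases hex : ∃ 𝓜 : RMMDP S A 𝒵 M, IsConsistent r L d h 𝓜
    · exact ⟨hex.choose, fun _ => hex.choose_spec⟩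
    · exact ⟨𝓜₀, fun h' => absurd h' hex⟩
  choose model hmodel using hmodel
  choose g hg using fun h => exists_chainSum_eq_optSum (stateKernel (model h)) (bon h) H
  choose best hbest using fun h => exists_nearly_optimal (model h) H (show 0 < ε / 3 by positivity)
  set J' : List (Trajectory S A 𝒵 H) → ℝ := fun h => optSum (stateKernel (model h)) (bon h) H []
    with hJ'
  set δ : ℝ := 6 * F * H * r with hδ
  -- the number of an episode before which the largest bonus in the planning model was small
  have hpick : ∀ l : List (Trajectory S A 𝒵 H), ∃ k, (∃ k < K, J' (l.take k) ≤ δ) →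
      k < K ∧ J' (l.take k) ≤ δ := by
    intro l
    by_cases hex : ∃ k < K, J' (l.take k) ≤ δ
    · exact ⟨hex.choose, fun _ => hex.choose_spec⟩
    · exact ⟨0, fun h' => absurd h' hex⟩
  choose pick hpick using hpick
  refine ⟨⟨fun h => ignoreRewards (g h),
    fun D => best ((List.ofFn D).take (pick (List.ofFn D)))⟩, fun 𝓜 => ?_⟩
  have hk := isKernel_trajProb 𝓜 fun h => (ignoreRewards (g h) : Policy S A 𝒵)
  -- concentration of the rewards, of the transitions, and of the bonuses
  have hb1 := chainSum_ind_not_closeCount_le hk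
    (ι := (B : {B // B ∈ smallSets H d}) × ((B.1 → S × A) × (B.1 → 𝒵)))
    (fun i => SAEvent i.1.1 i.2.1) (fun i => RewardEvent i.1.1 i.2.2)
    (fun i => moment 𝓜 i.2.1 i.2.2) (fun i => moment_nonneg 𝓜 _ _)
    (fun i h => sum_trajProb_rewardEvent 𝓜 (g h) i.1.1 i.2.1 i.2.2) hr hr1 L K K
  have hb2 := chainSum_ind_not_closeCount_le hk
    (ι := (t : Fin H) × ((prevSet t → S × A) × S))
    (fun i => SAEvent (prevSet i.1) i.2.1) (fun i => StateEvent i.1 i.2.2)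
    (fun i => transProb 𝓜 i.1 i.2.1 i.2.2) (fun i => (transProb_mem 𝓜 _ _).1 _)
    (fun i h => sum_trajProb_stateEvent 𝓜 (g h) i.1 i.2.1 i.2.2) hr hr1 L K K
  have hb3 := chainSum_ind_runSum_le hk
    (φ := fun h τ => totalBonus c d h (fun t => sa (τ t)) / F)
    (fun h τ => div_nonneg (totalBonus_nonneg hc0 h _) (by linarith))
    (fun h τ => (div_le_one (by linarith)).2 ((totalBonus_le c h _).trans hF)) L K
  have hcard1 := card_sigma_reward_le (S := S) (A := A) (H := H) (d := d) h𝒵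
  have hcard2 := card_sigma_state_le (S := S) (A := A) hd hd2
  refine le_successProb _ 𝓜 ?_ ((add_le_add (add_le_add hb1 hb2) hb3).trans (le_trans ?_ hη))
  swap
  · have hcard1' := hcard1.trans (mul_le_mul_of_nonneg_right hF (by positivity))
    gcongr
  intro D g1 g2 g3
  set l := List.ofFn D with hl
  have hlen : l.length = K := by simp [hl]
  have hcons : ∀ k < K, IsConsistent r L d (l.take k) 𝓜 := by
    intro k hk'
    constructor
    · intro B hB x z
      by_contra hcl
      exact g1 ⟨⟨⟨B, hB⟩, x, z⟩, k, hk', hcl⟩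
    · intro t x s
      by_contra hcl
      exact g2 ⟨⟨t, x, s⟩, k, hk', hcl⟩
  have hcons' : ∀ k < K, IsConsistent r L d (l.take k) (model (l.take k)) := fun k hk' =>
    hmodel _ ⟨𝓜, hcons k hk'⟩
  have hex : ∃ k < K, J' (l.take k) ≤ δ := by
    obtain ⟨k, hk', hlt⟩ := exists_chainSum_lt hc0 hF1 hF x₀ 𝓜 g l hlen (not_lt.1 g3) hK
    refine ⟨k, hk', ?_⟩
    by_contra hno
    have h1 : δ < J' (l.take k) := not_le.1 hno
    simp only [hJ', ← hg] at h1
    exact absurd hlt (not_lt.2 (le_chainSum_of_lt_chainSum hr hL hc hd hd2 hF1 hH hF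
      (hcons k hk') (hcons' k hk') x₀ (g (l.take k)) h1))
  obtain ⟨hpk, hpJ⟩ := hpick l hex
  have hJ := optSum_le_of_optSum_le hr hL hc hd hd2 hF1 hH hF (hcons _ hpk) (hcons' _ hpk) x₀ hpJ
  exact isEpsOptimal_of_abs_value_sub_le
    (fun π => (abs_value_sub_le h𝒵1 hdd hr hL hc hd hd2 (hcons _ hpk) (hcons' _ hpk) x₀
      le_rfl π).trans (hfinal _ hJ)) (hbest _) (by linarith)

end Learning

/-! ### Choice of parameters -/

section Parameters

theorem card_smallSets_le (H d : ℕ) : ((smallSets H d).card : ℝ) ≤ (1 + H : ℝ) ^ d := by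
  have h1 : smallSets H d ⊆ (Finset.range (d + 1)).biUnion
      fun i => (Finset.univ : Finset (Fin H)).powersetCard i := by
    intro B hB
    have hB : B.card ≤ d := by simpa [smallSets] using hB
    rw [Finset.mem_biUnion]
    exact ⟨B.card, Finset.mem_range.2 (by omega),
      Finset.mem_powersetCard.2 ⟨Finset.subset_univ _, rfl⟩⟩
  have h2 : (smallSets H d).card ≤ (1 + H) ^ d := by
    calc (smallSets H d).card ≤ ∑ i ∈ Finset.range (d + 1),
          ((Finset.univ : Finset (Fin H)).powersetCard i).card :=
          (Finset.card_le_card h1).trans Finset.card_biUnion_le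
      _ ≤ ∑ i ∈ Finset.range (d + 1), H ^ i * d.choose i := by
          refine Finset.sum_le_sum fun i hi => ?_
          rw [Finset.card_powersetCard, Finset.card_univ, Fintype.card_fin]
          exact (Nat.choose_le_pow _ _).trans (Nat.le_mul_of_pos_right _
            (Nat.choose_pos (by simpa [Nat.lt_succ_iff] using hi)))
      _ = (1 + H) ^ d := by
          rw [add_comm 1 H, add_pow]
          simp
  exact_mod_cast h2

/-- The accuracy `r = ε / (201 G ^ d)` makes the final value error small. -/
theorem value_error_le {H d : ℕ} (hd : 1 ≤ d) (hH : 1 ≤ H) {Z ε J : ℝ}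
    (hZ : 0 ≤ Z) (hε : 0 < ε)
    (hJ : J ≤ 3 * (1 + H : ℝ) ^ d * H * (7 * (1 + H : ℝ) ^ d * H *
      (ε / (201 * ((1 + 2 * H : ℝ) ^ 8 * (1 + Z)) ^ d)))) :
    H * ((1 + 2 * H : ℝ) ^ (2 * d) * (Z ^ d *
        (2 * (ε / (201 * ((1 + 2 * H : ℝ) ^ 8 * (1 + Z)) ^ d)) + J)))
      + H * (H * (2 * (ε / (201 * ((1 + 2 * H : ℝ) ^ 8 * (1 + Z)) ^ d)) + 2 * J)) ≤ ε / 3 := by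
  set r : ℝ := ε / (201 * ((1 + 2 * H : ℝ) ^ 8 * (1 + Z)) ^ d) with hr
  have hH' : (1 : ℝ) ≤ H := by exact_mod_cast hH
  have hr0 : 0 < r := by positivity
  set x : ℝ := (H : ℝ) with hx
  set F : ℝ := (1 + x) ^ d with hF
  set a : ℝ := (1 + 2 * x) ^ d with ha
  set q : ℝ := (1 + Z) ^ d with hq
  have hF1 : 1 ≤ F := one_le_pow₀ (by linarith)
  have hq1 : 1 ≤ q := one_le_pow₀ (by linarith)
  have ha1 : 1 ≤ a := one_le_pow₀ (by linarith)
  have hFa : F ≤ a := pow_le_pow_left₀ (by linarith) (by linarith) d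
  have hxa : x ≤ a := le_trans (by linarith : x ≤ 1 + 2 * x) (le_self_pow₀ (by linarith) (by omega))
  have hZq : Z ^ d ≤ q := pow_le_pow_left₀ hZ (by linarith) d
  have hr' : 201 * (a ^ 8 * q) * r = ε := by
    have h : ((1 + 2 * x) ^ 8 * (1 + Z)) ^ d = a ^ 8 * q := by
      rw [ha, hq, mul_pow, ← pow_mul, ← pow_mul, mul_comm 8 d]
    rw [hr, h]
    field_simp
  have hFx : 1 ≤ (F * x) ^ 2 := one_le_pow₀ (one_le_mul_of_one_le_of_one_le hF1 hH')
  have hJ1 : J ≤ 21 * ((F * x) ^ 2 * r) := hJ.trans (le_of_eq (by ring))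
  have hrr : r ≤ (F * x) ^ 2 * r := le_mul_of_one_le_left hr0.le hFx
  have e1 : 2 * r + J ≤ 23 * ((F * x) ^ 2 * r) := by linarith
  have e2 : 2 * r + 2 * J ≤ 44 * ((F * x) ^ 2 * r) := by linarith
  have hFxa : (F * x) ^ 2 * r ≤ (a * a) ^ 2 * r := by gcongr
  have s1 : x * ((1 + 2 * x) ^ (2 * d) * (Z ^ d * (2 * r + J)))
      ≤ a * (a ^ 2 * (q * (23 * ((a * a) ^ 2 * r)))) := by
    rw [mul_comm 2 d, pow_mul, ← ha]
    calc _ ≤ x * (a ^ 2 * (Z ^ d * (23 * ((a * a) ^ 2 * r)))) := by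
          gcongr
          linarith
      _ ≤ _ := by gcongr
  have s2 : x * (x * (2 * r + 2 * J)) ≤ a * (a * (44 * ((a * a) ^ 2 * r))) := by
    calc _ ≤ x * (x * (44 * ((a * a) ^ 2 * r))) := by
          gcongr
          linarith
      _ ≤ _ := by gcongr
  have s3 : a * (a ^ 2 * (q * (23 * ((a * a) ^ 2 * r)))) ≤ 23 * (a ^ 8 * q * r) := by
    have h1 : a ^ 7 * (q * r) ≤ a ^ 8 * (q * r) := by
      gcongr
      norm_num
    calc _ = 23 * (a ^ 7 * (q * r)) := by ring
      _ ≤ 23 * (a ^ 8 * (q * r)) := by linarith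
      _ = _ := by ring
  have s4 : a * (a * (44 * ((a * a) ^ 2 * r))) ≤ 44 * (a ^ 8 * q * r) := by
    have h1 : a ^ 6 * r ≤ a ^ 8 * (q * r) := by
      refine mul_le_mul (pow_le_pow_right₀ ha1 (by norm_num)) ?_ hr0.le (by positivity)
      exact le_mul_of_one_le_left hr0.le hq1
    calc _ = 44 * (a ^ 6 * r) := by ring
      _ ≤ 44 * (a ^ 8 * (q * r)) := by linarith
      _ = _ := by ring
  linarith

/-- The number of features times the failure probability of each of them is at most `η`. -/
theorem failure_le {K X Y η : ℝ} (hK : 1 ≤ K) (hη0 : 0 < η) (hη1 : η < 1)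
    (hX : X ≤ K) (hY : Y ≤ K) :
    2 * X * K * Real.exp (-(4 * (1 + Real.log (K / η))))
      + 2 * Y * K * Real.exp (-(4 * (1 + Real.log (K / η))))
      + Real.exp (-(4 * (1 + Real.log (K / η)))) ≤ η := by
  have hKη : 1 ≤ K / η := by rw [le_div_iff₀ hη0]; linarith
  set x := Real.log (K / η) with hx
  have hx0 : 0 ≤ x := Real.log_nonneg hKη
  have e1 : Real.exp (-(4 * (1 + x))) ≤ Real.exp (-4) * (Real.exp (-x) * Real.exp (-x)) := by
    rw [← Real.exp_add, ← Real.exp_add]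
    exact Real.exp_le_exp.2 (by linarith)
  have e2 : Real.exp (-x) = η / K := by
    rw [Real.exp_neg, hx, Real.exp_log (by linarith), inv_div]
  have e3 : Real.exp (-4) ≤ 1 / 5 := by
    rw [Real.exp_neg, ← one_div]
    refine one_div_le_one_div_of_le (by norm_num) ?_
    have := Real.add_one_le_exp (4 : ℝ)
    linarith
  rw [e2] at e1
  have e4 : Real.exp (-(4 * (1 + x))) ≤ 1 / 5 * (η / K * (η / K)) :=
    e1.trans (mul_le_mul_of_nonneg_right e3 (by positivity))
  set p := Real.exp (-(4 * (1 + x)))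
  have hp : 0 < p := Real.exp_pos _
  have e5 : 2 * X * K * p + 2 * Y * K * p + p ≤ 5 * (K * K) * p := by
    have h1 : X * (K * p) ≤ K * (K * p) := by gcongr
    have h2 : Y * (K * p) ≤ K * (K * p) := by gcongr
    have h3 : 1 * p ≤ K * K * p := by
      gcongr
      nlinarith
    nlinarith
  refine e5.trans ?_
  calc 5 * (K * K) * p ≤ 5 * (K * K) * (1 / 5 * (η / K * (η / K))) := by gcongr
    _ = η * η := by field_simp
    _ ≤ η := by nlinarith

/-- The number `K` of episodes makes the average bonus small. -/
theorem exploration_budget {n F g x ε K h : ℝ} (hn : 1 ≤ n) (hF : 1 ≤ F) (hg : 1 ≤ g)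
    (hx : 0 ≤ x) (hε0 : 0 < ε) (hε1 : ε < 1) (hh : h ≤ 1 + x)
    (hK : 2000000 * (n / ε ^ 2) * (F * g ^ 2) * (1 + x) ^ 2 ≤ K) :
    2 * (F * (4 * (4 * (1 + x)) / (ε / (201 * g)) * n * h) + F * (4 * (1 + x)))
      < K * (ε / (201 * g)) := by
  obtain ⟨r, hr⟩ : ∃ r, r = ε / (201 * g) := ⟨_, rfl⟩
  rw [← hr]
  have hr0 : 0 < r := hr ▸ div_pos hε0 (by positivity)
  have hr1 : r ≤ 1 := by
    rw [hr, div_le_one (by positivity)]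
    linarith
  have hεr : ε = r * (201 * g) := by rw [hr]; field_simp
  obtain ⟨T, hT⟩ : ∃ T, T = n * (1 + x) ^ 2 / r := ⟨_, rfl⟩
  have hT0 : 0 < T := by rw [hT]; positivity
  have e1 : 4 * (4 * (1 + x)) / r * n * h ≤ 16 * T := by
    calc _ ≤ 4 * (4 * (1 + x)) / r * n * (1 + x) :=
          mul_le_mul_of_nonneg_left hh (by positivity)
      _ = 16 * T := by rw [hT]; ring
  have e2 : 1 + x ≤ T := by
    rw [hT, le_div_iff₀ hr0]
    calc (1 + x) * r ≤ (1 + x) * 1 := mul_le_mul_of_nonneg_left hr1 (by linarith)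
      _ ≤ 1 * (1 + x) ^ 2 := by nlinarith
      _ ≤ _ := mul_le_mul_of_nonneg_right hn (by positivity)
  have e3 : F * (4 * (4 * (1 + x)) / r * n * h) ≤ F * (16 * T) :=
    mul_le_mul_of_nonneg_left e1 (by linarith)
  have e4 : F * (1 + x) ≤ F * T := mul_le_mul_of_nonneg_left e2 (by linarith)
  have e5 : 2000000 * (n / ε ^ 2) * (F * g ^ 2) * (1 + x) ^ 2 * r
      = 2000000 / 201 ^ 2 * (F * T) := by
    rw [hT, hεr]
    field_simp
  have e6 := mul_le_mul_of_nonneg_right hK hr0.le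
  have e7 : 0 < F * T := mul_pos (by linarith) hT0
  linarith

end Parameters

end RewardMixing

end

open RewardMixing in
theorem mainTheorem1 :
    ∃ (C : ℝ) (poly : MvPolynomial (Fin 3) ℝ) (polylog : Polynomial ℝ), 0 < C ∧
      ∀ (S A : Type) [Fintype S] [Fintype A] [Nonempty S] [Nonempty A]
        (𝒵 : Finset ℝ) (_ : ∀ z ∈ 𝒵, |z| ≤ 1)
        (M H d : ℕ) (_ : 2 ≤ M) (_ : 1 ≤ H) (_ : d = min (2 * M - 1) H)
        (ε η : ℝ) (_ : ε ∈ Set.Ioo 0 1) (_ : η ∈ Set.Ioo 0 1) (K : ℕ),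
        C * (((Fintype.card S : ℝ) * (Fintype.card A : ℝ)) ^ d / ε ^ 2)
            * (MvPolynomial.eval ![(d : ℝ), (H : ℝ), (𝒵.card : ℝ)] poly) ^ d
            * polylog.eval (Real.log ((K : ℝ) / η)) ≤ (K : ℝ) →
          ∃ L : Learner S A 𝒵 H K, ∀ 𝓜 : RMMDP S A 𝒵 M, 1 - η ≤ L.successProb 𝓜 ε := by
  -- `1 + H` bounds the number of sets of at most `d` times, and the square of the other factor is
  -- `1 / r ^ 2` up to `ε` and a constant
  refine ⟨2000000, (1 + MvPolynomial.X 1) *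
    ((1 + 2 * MvPolynomial.X 1) ^ 8 * (1 + MvPolynomial.X 2)) ^ 2, (1 + Polynomial.X) ^ 2,
    by norm_num, ?_⟩
  intro S A _ _ _ _ 𝒵 h𝒵 M H d hM hH hd ε η hε hη K hK
  have hd1 : 1 ≤ d := by omega
  have hd2 : 2 ≤ H → 2 ≤ d := by omega
  have hH' : (1 : ℝ) ≤ H := by exact_mod_cast hH
  have hZ : (0 : ℝ) ≤ 𝒵.card := Nat.cast_nonneg _
  have hN : (1 : ℝ) ≤ (Fintype.card S : ℝ) * Fintype.card A := one_le_card_mul_card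
  simp only [map_mul, map_add, map_pow, map_one, map_ofNat, MvPolynomial.eval_X,
    Matrix.cons_val, Polynomial.eval_pow, Polynomial.eval_add, Polynomial.eval_one,
    Polynomial.eval_X] at hK
  set N : ℝ := (Fintype.card S : ℝ) * Fintype.card A with hNdef
  set G : ℝ := (1 + 2 * (H : ℝ)) ^ 8 * (1 + (𝒵.card : ℝ)) with hG
  set x : ℝ := Real.log (K / η) with hx
  have hG1 : 1 ≤ G := one_le_mul_of_one_le_of_one_le (one_le_pow₀ (by linarith)) (by linarith)
  have hGd : 1 ≤ G ^ d := one_le_pow₀ hG1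
  have hNd : 1 ≤ N ^ d := one_le_pow₀ hN
  have hF1 : (1 : ℝ) ≤ (1 + H : ℝ) ^ d := one_le_pow₀ (by linarith)
  set F : ℝ := (1 + H : ℝ) ^ d with hF
  have hK' : 2000000 * (N ^ d / ε ^ 2) * (F * (G ^ d) ^ 2) * (1 + x) ^ 2 ≤ K := by
    have h : ((1 + (H : ℝ)) * G ^ 2) ^ d = F * (G ^ d) ^ 2 := by
      rw [hF, mul_pow, ← pow_mul, ← pow_mul, mul_comm 2 d]
    rwa [h] at hK
  -- for `K = 0` the logarithm has the junk value `0`, but the left-hand side is still positive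
  have hKpos : 0 < K := by
    rcases Nat.eq_zero_or_pos K with h0 | h0
    · exfalso
      have hx0 : x = 0 := by rw [hx, h0]; simp
      rw [hx0, h0] at hK'
      have hε0 := hε.1
      have : 0 < 2000000 * (N ^ d / ε ^ 2) * (F * (G ^ d) ^ 2) * (1 + 0) ^ 2 := by positivity
      simp only [Nat.cast_zero] at hK'
      linarith
    · exact h0
  have hK1 : (1 : ℝ) ≤ K := by exact_mod_cast hKpos
  have hlogK : Real.log K ≤ x := by
    refine Real.log_le_log (by linarith) ?_
    rw [le_div_iff₀ hη.1]
    nlinarith [hη.2, hη.1]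
  have hx0 : 0 ≤ x := (Real.log_nonneg hK1).trans hlogK
  -- `r` is the relative accuracy of the frequencies, and `exp (-L)` bounds the failure
  -- probability of each feature at each time
  set r : ℝ := ε / (201 * G ^ d) with hr
  have hr0 : 0 < r := div_pos hε.1 (by positivity)
  have hr1 : r ≤ 1 := by
    rw [hr, div_le_one (by positivity)]
    linarith [hε.2]
  set L : ℝ := 4 * (1 + x) with hL
  have hL4 : 4 ≤ L := by linarith
  have hKF : F * (N ^ d * G ^ d) ≤ K := by
    refine le_trans ?_ hK'
    have h1 : 1 ≤ 1 / ε ^ 2 := by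
      rw [le_div_iff₀ (pow_pos hε.1 2), one_mul]
      exact pow_le_one₀ hε.1.le hε.2.le
    have h2 : 1 ≤ (1 + x) ^ 2 := one_le_pow₀ (by linarith)
    calc F * (N ^ d * G ^ d) = 1 * (N ^ d * 1) * (F * (G ^ d) ^ 1) * 1 := by ring
      _ ≤ 2000000 * (N ^ d * (1 / ε ^ 2)) * (F * (G ^ d) ^ 2) * (1 + x) ^ 2 := by
          gcongr
          · norm_num
          · norm_num
      _ = _ := by ring
  refine exists_learner (M := M) (r := r) (L := L) (c := 4 * L / r) (F := F) h𝒵 hd hd1 hd2 hr0 hr1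
    (by linarith) ?_ hε.1 (card_smallSets_le H d) ?_ ?_ ?_
  · rw [← mul_div_assoc, div_add' _ _ _ hr0.ne', div_le_div_iff_of_pos_right hr0]
    linarith
  · refine failure_le hK1 hη.1 hη.2 (le_trans ?_ hKF) (le_trans ?_ hKF)
    · have h1 : (𝒵.card : ℝ) ≤ G := by
        have : 1 ≤ (1 + 2 * (H : ℝ)) ^ 8 := one_le_pow₀ (by linarith)
        rw [hG]; nlinarith
      gcongr
    · have h1 : (H : ℝ) ≤ F :=
        le_trans (by linarith) (le_self_pow₀ (by linarith) (by omega : d ≠ 0))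
      calc (H : ℝ) * N ^ d ≤ F * (N ^ d * 1) := by rw [mul_one]; gcongr
        _ ≤ F * (N ^ d * G ^ d) := by gcongr
  · have hharm : (harmonic K : ℝ) ≤ 1 + x := by
      have := harmonic_le_one_add_log K
      linarith
    exact exploration_budget hNd hF1 hGd hx0 hε.1 hε.2 hharm hK'
  · intro J hJ
    exact value_error_le hd1 hH hZ hε.1 hJ
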